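/- Throughout, $I\subseteq\mathbb R$ is a nonempty open interval (possibly unbounded), $c_1>0$ is a constant, and all curves are parametrized by arc length. Let $(N,h)$ be a Riemannian manifold and $f:I\to(0,\infty)$ smooth. A smooth unit speed curve $\gamma:I\to N$ has tension field $\tau(\gamma)=\nabla_{\gamma'}\gamma'$ and geodesic curvature $\kappa_1=|\tau(\gamma)|$. It is called $f$-biharmonic if on every compact interval $[p,q]\subset I$ it is a critical point, under smooth variations in $N$ supported in the interior of $[p,q]$, of $\int_p^q f\,|\tau(\gamma)|^2\,ds$; it is biharmonic if it is a critical point of $\frac12\int_p^q|\tau(\gamma)|^2\,ds$ in the same sense; and it is proper $f$-biharmonic if it is $f$-biharmonic but not biharmonic. $S^n$, $H^n$ and $\mathbb R^n$ are the complete simply connected model spaces of curvature $1$, $-1$ and $0$ (the unit sphere, the hyperboloid model, flat space), and a totally geodesic embedding is an isometric embedding that carries geodesics to geodesics. **Proposition.** (1) Let $C_4,C_5\in\mathbb R$ be not both zero, and put $w(s)=C_4\cos(2s)+C_5\sin(2s)+\sqrt{1+C_4^2+C_5^2}$. Let $\rho:I\to\mathbb R$ be twice differentiable with $\cos\rho\neq0$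 and $|\rho'|<1$ on $I$, let $$\rho''+(1-\rho'^2)\tan\rho+\frac{\sqrt{1-\rho'^2}}{w(s)}=0,$$ and let $\phi$ be an antiderivative of $\sqrt{1-\rho'^2}/\cos\rho$ on $I$. Then the curve $\gamma(s)=(\rho(s),\phi(s))$ in $S^2$ with the metric $d\rho^2+\cos^2\rho\,d\phi^2$, that is, $\gamma=(\cos\rho\cos\phi,\ \cos\rho\sin\phi,\ \sin\rho)$ in the unit sphere $S^2$, has geodesic curvature $\kappa_1=1/w$ and is proper $f$-biharmonic for $f=c_1w^{3/2}=c_1\kappa_1^{-3/2}$. For every $n$ and every totally geodesic embedding $\psi:S^2\to S^n$, the curve $\psi\circ\gamma$ in $S^n$ is proper $f$-biharmonic for the same $f$ and has the same geodesic curvature $1/w$. (2) Let $C_1,C_2>0$ with $4C_1C_2-1>0$, and put $w(s)=C_1e^{2s}+C_2e^{-2s}+\sqrt{4C_1C_2-1}$. Let $u:I\to\mathbb R$ be twice differentiable with $|u'|<1$ on $I$, let $$u''-(1-u'^2)+\frac{\sqrt{1-u'^2}}{w(s)}=0,$$ and let $v$ be an antiderivative of $\sqrt{1-u'^2}/e^{u}$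 on $I$. Then the curve $\gamma(s)=(u(s),v(s))$ in $H^2$ with the metric $du^2+e^{2u}dv^2$, that is, $\gamma=\left(\cosh u+\tfrac12e^uv^2,\ e^uv,\ \sinh u-\tfrac12e^uv^2\right)$ in the hyperboloid $\{-x_0^2+x_1^2+x_2^2=-1,\ x_0>0\}$, has geodesic curvature $\kappa_1=1/w$ and is proper $f$-biharmonic for $f=c_1w^{3/2}=c_1\kappa_1^{-3/2}$. For every $n$ and every totally geodesic embedding $\psi:H^2\to H^n$, the curve $\psi\circ\gamma$ in $H^n$ is proper $f$-biharmonic for the same $f$ and has the same geodesic curvature $1/w$. (3) Let $C_3>0$ and $C_4\in\mathbb R$, and put $\kappa(s)=\dfrac{4C_3}{16+C_3^2(s+C_4)^2}$. Let $x:I\to\mathbb R$ be twice differentiable with $|x'|<1$ on $I$, let $$x''+\frac{4C_3\sqrt{1-x'^2}}{16+C_3^2(s+C_4)^2}=0,$$ and let $y$ be an antiderivative of $\sqrt{1-x'^2}$ on $I$. Then the planar curve $\gamma(s)=(x(s),y(s))$ in $(\mathbb R^2,dx^2+dy^2)$ has geodesic curvature $\kappa_1=\kappa$ and is proper $f$-biharmonic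 for $f=c_1\kappa^{-3/2}$. For every $n$ and every totally geodesic embedding $\psi:\mathbb R^2\to\mathbb R^n$, the curve $\psi\circ\gamma$ in $\mathbb R^n$ is proper $f$-biharmonic for the same $f$ and has the same geodesic curvature $\kappa$. -/

import Mathlib

open scoped ContDiff

noncomputable section

/-- A subset `carrier` of a normed space `E`, together with a function `form` on pairs of ambient
vectors. It is used only for `roundSphere`, `hyperbolicSpace` and `euclideanSpace` below, where
`carrier` is an embedded submanifold, `form` is a nondegenerate symmetric bilinear form that is
positive definite on every tangent space, and the Riemannian metric is the restriction of `form` to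
the tangent spaces. -/
structure EmbeddedSpace (E : Type*) where
  carrier : Set E
  form : E → E → ℝ

/-- The unit sphere `S^n` in `ℝ^{n+1}` with the round metric. -/
def roundSphere (n : ℕ) : EmbeddedSpace (EuclideanSpace ℝ (Fin (n + 1))) where
  carrier := Metric.sphere 0 1
  form x y := inner ℝ x y

/-- The Lorentz form `-x₀y₀ + x₁y₁ + ⋯ + xₙyₙ`. -/
def lorentzForm {n : ℕ} (x y : EuclideanSpace ℝ (Fin (n + 1))) : ℝ :=
  -(x 0 * y 0) + ∑ i : Fin n, x i.succ * y i.succ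

/-- Hyperbolic space `H^n` of curvature `-1`: the upper sheet of the hyperboloid `⟨x, x⟩ = -1` in
Minkowski space, with the metric induced by the Lorentz form. -/
def hyperbolicSpace (n : ℕ) : EmbeddedSpace (EuclideanSpace ℝ (Fin (n + 1))) where
  carrier := {x | lorentzForm x x = -1 ∧ 0 < x 0}
  form := lorentzForm

/-- Flat `ℝ^n`. -/
def euclideanSpace (n : ℕ) : EmbeddedSpace (EuclideanSpace ℝ (Fin n)) where
  carrier := Set.univ
  form x y := inner ℝ x y

section Geometry

variable {E E' : Type*} [NormedAddCommGroup E] [NormedSpace ℝ E]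
  [NormedAddCommGroup E'] [NormedSpace ℝ E']

/-- The tangent space of `M` at `x`: the velocities at `x` of the smooth curves in `M`. -/
def tangentVectors (M : EmbeddedSpace E) (x : E) : Set E :=
  {v | ∃ c : ℝ → E, ContDiff ℝ ∞ c ∧ (∀ t, c t ∈ M.carrier) ∧ c 0 = x ∧ deriv c 0 = v}

/-- `v` is the orthogonal projection of the ambient vector `w` to the tangent space of `M` at `x`. -/
def IsTangentialPart (M : EmbeddedSpace E) (x w v : E) : Prop :=
  v ∈ tangentVectors M x ∧ ∀ y ∈ tangentVectors M x, M.form (w - v) y = 0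

open Classical in
/-- The orthogonal projection of the ambient vector `w` to the tangent space of `M` at `x`. -/
def tangentialPart (M : EmbeddedSpace E) (x w : E) : E :=
  if h : ∃ v, IsTangentialPart M x w v then h.choose else 0

/-- The Levi-Civita covariant derivative `∇_{c'} V` of a vector field `V` along a curve `c` in the
submanifold `M`: the tangential part of the ambient derivative. -/
def covDerivAlong (M : EmbeddedSpace E) (c V : ℝ → E) (s : ℝ) : E :=
  tangentialPart M (c s) (deriv V s)

/-- The tension field `τ(c) = ∇_{c'} c'` of a curve. -/
def tension (M : EmbeddedSpace E) (c : ℝ → E) : ℝ → E :=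
  covDerivAlong M c (deriv c)

/-- The geodesic curvature `κ₁ = |∇_{c'} c'|` of a unit speed curve. -/
def geodesicCurvature (M : EmbeddedSpace E) (c : ℝ → E) (s : ℝ) : ℝ :=
  √(M.form (tension M c s) (tension M c s))

/-- The bienergy `½ ∫_p^q |τ(c)|² ds`. -/
def bienergy (M : EmbeddedSpace E) (c : ℝ → E) (p q : ℝ) : ℝ :=
  (1 / 2) * ∫ s in p..q, M.form (tension M c s) (tension M c s)

/-- The `f`-bienergy `∫_p^q f |τ(c)|² ds`. -/
def fBienergy (M : EmbeddedSpace E) (f : ℝ → ℝ) (c : ℝ → E) (p q : ℝ) : ℝ :=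
  ∫ s in p..q, f s * M.form (tension M c s) (tension M c s)

/-- `F (t, s)`, for `|t| < ε` and `s ∈ I`, is a smooth variation in `M` of the curve `c : I → M`
that is supported in a compact subset of the open interval `(p, q)`. -/
structure IsVariation (M : EmbeddedSpace E) (I : Set ℝ) (c : ℝ → E) (p q ε : ℝ)
    (F : ℝ × ℝ → E) : Prop where
  smooth : ContDiffOn ℝ ∞ F (Set.Ioo (-ε) ε ×ˢ I)
  mem : ∀ t ∈ Set.Ioo (-ε) ε, ∀ s ∈ I, F (t, s) ∈ M.carrier
  initial : ∀ s ∈ I, F (0, s) = c s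
  support : ∃ p' q' : ℝ, p < p' ∧ q' < q ∧
    ∀ t ∈ Set.Ioo (-ε) ε, ∀ s ∈ I, s ∉ Set.Icc p' q' → F (t, s) = c s

/-- `c : I → M` is a critical point of the functional `Φ`: on each compact interval `[p, q] ⊆ I`
the first variation of `Φ` vanishes for all variations supported inside `[p, q]`. -/
def IsCriticalPoint (M : EmbeddedSpace E) (I : Set ℝ) (Φ : (ℝ → E) → ℝ → ℝ → ℝ)
    (c : ℝ → E) : Prop :=
  ∀ p ∈ I, ∀ q ∈ I, p < q → ∀ ε > 0, ∀ F : ℝ × ℝ → E, IsVariation M I c p q ε F →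
    HasDerivAt (fun t : ℝ => Φ (fun s => F (t, s)) p q) 0 0

/-- `c` is a smooth unit speed curve `I → M`. -/
structure IsUnitSpeedCurve (M : EmbeddedSpace E) (I : Set ℝ) (c : ℝ → E) : Prop where
  smooth : ContDiffOn ℝ ∞ c I
  mem : ∀ s ∈ I, c s ∈ M.carrier
  unit : ∀ s ∈ I, M.form (deriv c s) (deriv c s) = 1

/-- Biharmonic curves: unit speed curves that are critical points of the bienergy. -/
structure IsBiharmonicCurve (M : EmbeddedSpace E) (I : Set ℝ) (c : ℝ → E) : Prop where
  curve : IsUnitSpeedCurve M I c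
  critical : IsCriticalPoint M I (bienergy M) c

/-- `f`-biharmonic curves: unit speed curves that are critical points of the `f`-bienergy, where
`f : I → (0, ∞)` is smooth. -/
structure IsFBiharmonicCurve (M : EmbeddedSpace E) (I : Set ℝ) (f : ℝ → ℝ) (c : ℝ → E) :
    Prop where
  weight_smooth : ContDiffOn ℝ ∞ f I
  weight_pos : ∀ s ∈ I, 0 < f s
  curve : IsUnitSpeedCurve M I c
  critical : IsCriticalPoint M I (fBienergy M f) c

/-- Proper `f`-biharmonic curves: `f`-biharmonic but not biharmonic. -/
def IsProperFBiharmonicCurve (M : EmbeddedSpace E) (I : Set ℝ) (f : ℝ → ℝ) (c : ℝ → E) : Prop :=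
  IsFBiharmonicCurve M I f c ∧ ¬ IsBiharmonicCurve M I c

/-- A complete geodesic of `M`. -/
structure IsGeodesic (M : EmbeddedSpace E) (c : ℝ → E) : Prop where
  smooth : ContDiff ℝ ∞ c
  mem : ∀ t, c t ∈ M.carrier
  tension_eq_zero : ∀ t, tension M c t = 0

/-- `ψ : M → N` is a totally geodesic (isometric) embedding: a smooth map that is a homeomorphism
onto its image, preserves the length of tangent vectors, and carries geodesics to geodesics. -/
structure IsTotallyGeodesicEmbedding (M : EmbeddedSpace E) (N : EmbeddedSpace E') (ψ : E → E') :
    Prop where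
  smooth : ContDiffOn ℝ ∞ ψ M.carrier
  mapsTo : Set.MapsTo ψ M.carrier N.carrier
  embedding : Topology.IsEmbedding (M.carrier.domRestrict ψ)
  isometric : ∀ c : ℝ → E, ContDiff ℝ ∞ c → (∀ t, c t ∈ M.carrier) → ∀ t,
    N.form (deriv (ψ ∘ c) t) (deriv (ψ ∘ c) t) = M.form (deriv c t) (deriv c t)
  geodesic : ∀ c : ℝ → E, IsGeodesic M c → IsGeodesic N (ψ ∘ c)

end Geometry

/-- The point of `S²` with coordinates `(ρ, φ)` in which the round metric is `dρ² + cos²ρ dφ²`. -/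
def spherePoint (ρ φ : ℝ) : EuclideanSpace ℝ (Fin 3) :=
  !₂[Real.cos ρ * Real.cos φ, Real.cos ρ * Real.sin φ, Real.sin ρ]

/-- The point of `H²` with coordinates `(u, v)` in which the metric is `du² + e^{2u} dv²`. -/
def hyperbolicPoint (u v : ℝ) : EuclideanSpace ℝ (Fin 3) :=
  !₂[Real.cosh u + Real.exp u * v ^ 2 / 2, Real.exp u * v, Real.sinh u - Real.exp u * v ^ 2 / 2]

/-- The point of `ℝ²` with Cartesian coordinates `(x, y)`. -/
def planePoint (x y : ℝ) : EuclideanSpace ℝ (Fin 2) :=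
  !₂[x, y]

theorem spherePoint_mem (ρ φ : ℝ) : spherePoint ρ φ ∈ (roundSphere 2).carrier := by
  have h : ‖spherePoint ρ φ‖ ^ 2 = 1 := by
    rw [EuclideanSpace.norm_sq_eq]
    simp [Fin.sum_univ_three, spherePoint]
    nlinarith [Real.sin_sq_add_cos_sq ρ, Real.sin_sq_add_cos_sq φ]
  simp only [roundSphere, mem_sphere_zero_iff_norm]
  nlinarith [norm_nonneg (spherePoint ρ φ)]

theorem hasDerivAt_of_coords {n : ℕ} {c : ℝ → EuclideanSpace ℝ (Fin n)}
    {w : EuclideanSpace ℝ (Fin n)} {s : ℝ} (h : ∀ i, HasDerivAt (fun t => c t i) (w i) s) :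
    HasDerivAt c w s := by
  exact ((PiLp.continuousLinearEquiv 2 ℝ fun _ : Fin n => ℝ).symm.hasFDerivAt).comp_hasDerivAt s
    (hasDerivAt_pi.2 h)

/-- In the coordinates `(ρ, φ)` the metric of `S²` is `dρ² + cos²ρ dφ²`. -/
theorem spherePoint_metric (ρ φ : ℝ → ℝ) (ρ₁ φ₁ s : ℝ) (hρ : HasDerivAt ρ ρ₁ s)
    (hφ : HasDerivAt φ φ₁ s) :
    (roundSphere 2).form (deriv (fun t => spherePoint (ρ t) (φ t)) s)
      (deriv (fun t => spherePoint (ρ t) (φ t)) s) = ρ₁ ^ 2 + Real.cos (ρ s) ^ 2 * φ₁ ^ 2 := by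
  have h : HasDerivAt (fun t => spherePoint (ρ t) (φ t))
      (!₂[-Real.sin (ρ s) * ρ₁ * Real.cos (φ s) + Real.cos (ρ s) * (-Real.sin (φ s) * φ₁),
        -Real.sin (ρ s) * ρ₁ * Real.sin (φ s) + Real.cos (ρ s) * (Real.cos (φ s) * φ₁),
        Real.cos (ρ s) * ρ₁]) s := by
    apply hasDerivAt_of_coords
    intro i
    fin_cases i
    · exact hρ.cos.mul hφ.cos
    · exact hρ.cos.mul hφ.sin
    · exact hρ.sin
  rw [h.deriv]
  simp [roundSphere, PiLp.inner_apply, Fin.sum_univ_three]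
  linear_combination (Real.sin (ρ s) ^ 2 * ρ₁ ^ 2 + Real.cos (ρ s) ^ 2 * φ₁ ^ 2) *
    Real.sin_sq_add_cos_sq (φ s) + ρ₁ ^ 2 * Real.sin_sq_add_cos_sq (ρ s)

theorem hyperbolicPoint_mem (u v : ℝ) : hyperbolicPoint u v ∈ (hyperbolicSpace 2).carrier := by
  refine ⟨?_, ?_⟩
  · simp [lorentzForm, hyperbolicPoint, Fin.sum_univ_two, Real.cosh_eq, Real.sinh_eq, Real.exp_neg]
    field_simp
    ring
  · simp only [hyperbolicPoint]
    have := Real.cosh_pos u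
    simp
    positivity

/-- In the coordinates `(u, v)` the metric of `H²` is `du² + e^{2u} dv²`. -/
theorem hyperbolicPoint_metric (u v : ℝ → ℝ) (u₁ v₁ s : ℝ) (hu : HasDerivAt u u₁ s)
    (hv : HasDerivAt v v₁ s) :
    (hyperbolicSpace 2).form (deriv (fun t => hyperbolicPoint (u t) (v t)) s)
      (deriv (fun t => hyperbolicPoint (u t) (v t)) s) =
      u₁ ^ 2 + Real.exp (2 * u s) * v₁ ^ 2 := by
  have h : HasDerivAt (fun t => hyperbolicPoint (u t) (v t))
      (!₂[Real.sinh (u s) * u₁ + (Real.exp (u s) * u₁ * v s ^ 2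
            + Real.exp (u s) * (2 * v s * v₁)) / 2,
        Real.exp (u s) * u₁ * v s + Real.exp (u s) * v₁,
        Real.cosh (u s) * u₁ - (Real.exp (u s) * u₁ * v s ^ 2
            + Real.exp (u s) * (2 * v s * v₁)) / 2]) s := by
    have hv2 : HasDerivAt (fun t => v t ^ 2) (2 * v s * v₁) s :=
      (hv.fun_pow 2).congr_deriv (by simp)
    apply hasDerivAt_of_coords
    intro i
    fin_cases i
    · exact hu.cosh.add ((hu.exp.mul hv2).div_const 2)
    · exact hu.exp.mul hv
    · exact hu.sinh.sub ((hu.exp.mul hv2).div_const 2)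
  rw [h.deriv]
  have he : Real.exp (2 * u s) = Real.exp (u s) ^ 2 := by rw [← Real.exp_nat_mul]; norm_num
  simp [hyperbolicSpace, lorentzForm, Fin.sum_univ_two, Real.cosh_eq, Real.sinh_eq, Real.exp_neg,
    he]
  field_simp
  ring

end

noncomputable section

open Set Filter Topology MeasureTheory

/-! ### Calculus of two-parameter families of curves. -/

section Calculus

variable {E : Type*} [NormedAddCommGroup E] [NormedSpace ℝ E]

/-! The three planes are treated at once as model spaces of curvature `ε ∈ {1, -1, 0}`, realised as
quadrics `⟨x, x⟩ = ε` when `ε ≠ 0`. There the tension of any curve, of unit speed or not, is `c'' +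
ε⟨c', c'⟩ c`, and so `|τ|² = ⟨c'', c''⟩ - ε⟨c', c'⟩²` (`IsSpaceForm.form_tension`). The `f`-bienergy
thus becomes an integral of ordinary derivatives.

For a unit speed curve with Frenet equations `T' = κN - εc`, `N' = -κT`, put `g = fκ`.
Differentiating under the integral and integrating by parts twice
(`IsFrenetCurve.hasDerivAt_fBienergy`) gives the Euler–Lagrange equations `g'' - gκ² + εg = 0`
(normal) and `2g'κ + gκ' = 0` (tangential). The tangential one says that `g²κ` is constant, which
explains `f = c₁ κ^(-3/2)`. With `κ = 1/w`, that is `g = c₁√w`, the normal one becomes `2ww'' - w'²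
= 4 - 4εw²`, and each `w` of the theorem solves it; this is what fixes the square roots in the
formulas for `w`. For constant `f` the tangential equation reads `κκ' = 0`, so a nonconstant `κ`
rules out biharmonicity (`IsFrenetCurve.not_isBiharmonicCurve`).

The prescribed equation for the first coordinate says exactly that the curve has signed curvature
`κ` in the frame built from the coordinate directions (`isFrenetCurve_spherePoint` and its
analogues).

A totally geodesic embedding maps the geodesics through a base point to geodesics. These fill the
surface, so the embedding is the restriction of an affine map preserving the forms
(`IsSpaceForm.exists_affine`). Such a map carries Frenet frames to Frenet frames with the same `κ`,
and the argument applies unchanged in the target. -/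

theorem HasDerivAt.bilin {B : E →L[ℝ] E →L[ℝ] ℝ} {u v : ℝ → E} {u' v' : E} {x : ℝ}
    (hu : HasDerivAt u u' x) (hv : HasDerivAt v v' x) :
    HasDerivAt (fun x => B (u x) (v x)) (B (u x) v' + B u' (v x)) x :=
  B.hasDerivAt_of_bilinear (fun _ => hu) fun _ => hv

theorem ContDiffOn.bilin {X : Type*} [NormedAddCommGroup X] [NormedSpace ℝ X] {n : ℕ∞ω}
    {B : E →L[ℝ] E →L[ℝ] ℝ} {u v : X → E} {U : Set X}
    (hu : ContDiffOn ℝ n u U) (hv : ContDiffOn ℝ n v U) :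
    ContDiffOn ℝ n (fun x => B (u x) (v x)) U :=
  (B.contDiff.comp_contDiffOn hu).clm_apply hv

theorem ContinuousOn.bilin {X : Type*} [TopologicalSpace X]
    {B : E →L[ℝ] E →L[ℝ] ℝ} {u v : X → E} {U : Set X}
    (hu : ContinuousOn u U) (hv : ContinuousOn v U) :
    ContinuousOn (fun x => B (u x) (v x)) U :=
  (B.continuous.comp_continuousOn hu).clm_apply hv

/-- The directional derivative of a function on the plane. -/
def dirDeriv (v : ℝ × ℝ) (F : ℝ × ℝ → E) (x : ℝ × ℝ) : E := fderiv ℝ F x v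

variable {U : Set (ℝ × ℝ)} {F : ℝ × ℝ → E}

theorem ContDiffOn.dirDeriv (hF : ContDiffOn ℝ ∞ F U) (hU : IsOpen U) (v : ℝ × ℝ) :
    ContDiffOn ℝ ∞ (dirDeriv v F) U :=
  (hF.fderiv_of_isOpen hU (m := ∞) (by simp)).clm_apply contDiffOn_const

theorem dirDeriv_comm (hF : ContDiffOn ℝ ∞ F U) (hU : IsOpen U) (v w : ℝ × ℝ) {x : ℝ × ℝ}
    (hx : x ∈ U) : dirDeriv v (dirDeriv w F) x = dirDeriv w (dirDeriv v F) x := by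
  have hsymm : IsSymmSndFDerivAt ℝ F x :=
    (hF.contDiffAt (hU.mem_nhds hx)).isSymmSndFDerivAt
      (by simpa using WithTop.coe_le_coe.2 (le_top : (2 : ℕ∞) ≤ ⊤))
  have hd : DifferentiableAt ℝ (fderiv ℝ F) x :=
    ((hF.fderiv_of_isOpen hU (m := ∞) (by simp)).contDiffAt (hU.mem_nhds hx)).differentiableAt
      (by simp)
  have key : ∀ a b : ℝ × ℝ, dirDeriv a (dirDeriv b F) x = fderiv ℝ (fderiv ℝ F) x a b := by
    intro a b
    have h := (hd.hasFDerivAt.clm_apply (hasFDerivAt_const b x)).fderiv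
    change fderiv ℝ (fun y => fderiv ℝ F y b) x a = _
    rw [h]
    simp
  rw [key, key, hsymm]

theorem dirDeriv_congr (hU : IsOpen U) {G : ℝ × ℝ → E} (h : ∀ x ∈ U, F x = G x) (v : ℝ × ℝ)
    {x : ℝ × ℝ} (hx : x ∈ U) : dirDeriv v F x = dirDeriv v G x := by
  have : F =ᶠ[𝓝 x] G := by
    filter_upwards [hU.mem_nhds hx] with y hy using h y hy
  rw [dirDeriv, dirDeriv, this.fderiv_eq]

theorem hasDerivAt_slice_right (hF : ContDiffOn ℝ ∞ F U) (hU : IsOpen U) {t s : ℝ}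
    (hx : (t, s) ∈ U) : HasDerivAt (fun s => F (t, s)) (dirDeriv (0, 1) F (t, s)) s := by
  have h := ((hF.contDiffAt (hU.mem_nhds hx)).differentiableAt (by simp)).hasFDerivAt
  exact h.comp_hasDerivAt (f := fun s => (t, s)) s ((hasDerivAt_const s t).prodMk (hasDerivAt_id s))

theorem hasDerivAt_slice_left (hF : ContDiffOn ℝ ∞ F U) (hU : IsOpen U) {t s : ℝ}
    (hx : (t, s) ∈ U) : HasDerivAt (fun t => F (t, s)) (dirDeriv (1, 0) F (t, s)) t := by
  have h := ((hF.contDiffAt (hU.mem_nhds hx)).differentiableAt (by simp)).hasFDerivAt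
  exact h.comp_hasDerivAt (f := fun t => (t, s)) t ((hasDerivAt_id t).prodMk (hasDerivAt_const t s))

/-- Differentiation under the integral sign over a compact interval. -/
theorem hasDerivAt_intervalIntegral_of_contDiffOn {I : Set ℝ} (hI : IsOpen I) {p q ε : ℝ}
    (hε : 0 < ε) (hpq : p ≤ q) (hsub : Icc p q ⊆ I) {G : ℝ × ℝ → ℝ}
    (hG : ContDiffOn ℝ ∞ G (Ioo (-ε) ε ×ˢ I)) :
    HasDerivAt (fun t => ∫ s in p..q, G (t, s)) (∫ s in p..q, dirDeriv (1, 0) G (0, s)) 0 := by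
  have hU : IsOpen (Ioo (-ε) ε ×ˢ I) := isOpen_Ioo.prod hI
  have hG' := (hG.dirDeriv hU (1, 0)).continuousOn
  -- Halving the range of `t` yields a compact rectangle, on which the `t`-derivative is bounded;
  -- the constant bound dominates.
  have hKU : Icc (-(ε / 2)) (ε / 2) ×ˢ Icc p q ⊆ Ioo (-ε) ε ×ˢ I :=
    prod_mono (fun x hx => ⟨by linarith [hx.1], by linarith [hx.2]⟩) hsub
  obtain ⟨b, hb⟩ := (isCompact_Icc.prod isCompact_Icc).exists_bound_of_continuousOn (hG'.mono hKU)
  have slice : ∀ {H : ℝ × ℝ → ℝ}, ContinuousOn H (Ioo (-ε) ε ×ˢ I) → ∀ t ∈ Ioo (-ε) ε,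
      IntervalIntegrable (fun s => H (t, s)) volume p q := by
    intro H hH t ht
    apply ContinuousOn.intervalIntegrable
    rw [uIcc_of_le hpq]
    exact hH.comp (by fun_prop) fun s hs => ⟨ht, hsub hs⟩
  have h0 : (0 : ℝ) ∈ Ioo (-ε) ε := ⟨by linarith, hε⟩
  have hI' : ∀ s ∈ uIoc p q, s ∈ Icc p q := by
    intro s hs
    rw [uIoc_of_le hpq] at hs
    exact Ioc_subset_Icc_self hs
  refine (intervalIntegral.hasDerivAt_integral_of_dominated_loc_of_deriv_le
    (F := fun t s => G (t, s)) (F' := fun t s => dirDeriv (1, 0) G (t, s)) (bound := fun _ => b)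
    (s := Ioo (-(ε / 2)) (ε / 2)) (Ioo_mem_nhds (by linarith) (by linarith)) ?_
    (slice hG.continuousOn 0 h0) (intervalIntegrable_iff.1 (slice hG' 0 h0)).aestronglyMeasurable
    ?_ (by simp) ?_).2
  · filter_upwards [Ioo_mem_nhds h0.1 h0.2] with t ht
    exact (intervalIntegrable_iff.1 (slice hG.continuousOn t ht)).aestronglyMeasurable
  · exact ae_of_all _ fun s hs t ht => hb (t, s) ⟨Ioo_subset_Icc_self ht, hI' s hs⟩
  · exact ae_of_all _ fun s hs t ht => hasDerivAt_slice_left hG hU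
      (hKU ⟨Ioo_subset_Icc_self ht, hI' s hs⟩)

end Calculus

/-! ### Model spaces and Frenet curves in them. -/

section SpaceForms

variable {E : Type*} [NormedAddCommGroup E] [NormedSpace ℝ E]

/-- `M` is the model space of curvature `ε ∈ {-1, 0, 1}` for the bilinear form `B`, embedded as a
hyperquadric if `ε ≠ 0`; `C` and `S` are the generalized cosine and sine. -/
structure IsSpaceForm (M : EmbeddedSpace E) (B : E →L[ℝ] E →L[ℝ] ℝ) (ε : ℝ) (C S : ℝ → ℝ) :
    Prop where
  form_eq : ∀ x y, M.form x y = B x y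
  symm : ∀ x y, B x y = B y x
  cube : ε ^ 3 = ε
  self : ∀ x ∈ M.carrier, ε * B x x = ε ^ 2
  pos : ∀ x ∈ M.carrier, ∀ v, ε * B x v = 0 → v ≠ 0 → 0 < B v v
  exp_mem : ∀ x ∈ M.carrier, ∀ v, ε * B x v = 0 → B v v = 1 → ∀ t, C t • x + S t • v ∈ M.carrier
  smooth_cos : ContDiff ℝ ∞ C
  smooth_sin : ContDiff ℝ ∞ S
  hasDerivAt_cos : ∀ t, HasDerivAt C (-ε * S t) t
  hasDerivAt_sin : ∀ t, HasDerivAt S (C t) t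
  cos_zero : C 0 = 1
  sin_zero : S 0 = 0
  cos_sq_add : ∀ t, C t ^ 2 + ε * S t ^ 2 = 1
  cos_of_flat : ∀ t, (1 - ε ^ 2) * (C t - 1) = 0

namespace IsSpaceForm

variable {M : EmbeddedSpace E} {B : E →L[ℝ] E →L[ℝ] ℝ} {ε : ℝ} {C S : ℝ → ℝ}

/-- Differentiate the equation of the quadric, `ε⟨c, c⟩ = ε²`; in the flat case there is no
constraint. -/
theorem tangent_of_hasDerivAt (hM : IsSpaceForm M B ε C S) {c : ℝ → E} {v : E} {s : ℝ}
    (hc : HasDerivAt c v s) (hmem : ∀ᶠ t in 𝓝 s, c t ∈ M.carrier) : ε * B (c s) v = 0 := by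
  have h1 : HasDerivAt (fun t => ε * B (c t) (c t)) (ε * (B (c s) v + B v (c s))) s :=
    (hc.bilin hc).const_mul ε
  have h2 : HasDerivAt (fun t => ε * B (c t) (c t)) 0 s :=
    (hasDerivAt_const s (ε ^ 2)).congr_of_eventuallyEq (hmem.mono fun t ht => hM.self _ ht)
  have h3 := h1.unique h2
  rw [hM.symm v] at h3
  linarith

theorem contDiff_exp (hM : IsSpaceForm M B ε C S) (x v : E) (r : ℝ) :
    ContDiff ℝ ∞ fun t => C (r * t) • x + S (r * t) • v :=
  ((hM.smooth_cos.comp (contDiff_const.mul contDiff_id)).smul contDiff_const).add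
    ((hM.smooth_sin.comp (contDiff_const.mul contDiff_id)).smul contDiff_const)

theorem hasDerivAt_exp (hM : IsSpaceForm M B ε C S) (x v : E) (r t : ℝ) :
    HasDerivAt (fun t => C (r * t) • x + S (r * t) • v)
      ((-ε * S (r * t) * r) • x + (C (r * t) * r) • v) t := by
  have hr : HasDerivAt (fun t => r * t) r t := by simpa using (hasDerivAt_id t).const_mul r
  exact (((hM.hasDerivAt_cos _).comp t hr).smul_const x).add
    (((hM.hasDerivAt_sin _).comp t hr).smul_const v)

/-- The geodesic in direction `v / |v|`, run at speed `|v|`; the zero vector needs a constant curve.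
-/
theorem exists_curve (hM : IsSpaceForm M B ε C S) {x v : E} (hx : x ∈ M.carrier)
    (hv : ε * B x v = 0) :
    ∃ c : ℝ → E, ContDiff ℝ ∞ c ∧ (∀ t, c t ∈ M.carrier) ∧ c 0 = x ∧ HasDerivAt c v 0 := by
  by_cases h0 : v = 0
  · exact ⟨fun _ => x, contDiff_const, fun _ => hx, rfl, h0 ▸ hasDerivAt_const _ _⟩
  have hpos := hM.pos x hx v hv h0
  set r := √(B v v) with hr
  have hr0 : 0 < r := Real.sqrt_pos.2 hpos
  have hr2 : r ^ 2 = B v v := Real.sq_sqrt hpos.le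
  refine ⟨fun t => C (r * t) • x + S (r * t) • (r⁻¹ • v), hM.contDiff_exp _ _ _, fun t => ?_, ?_,
    ?_⟩
  · refine hM.exp_mem x hx _ ?_ ?_ _
    · simp only [map_smul, smul_eq_mul]
      linear_combination r⁻¹ * hv
    · simp only [map_smul, smul_eq_mul, smul_apply, ← hr2]
      field_simp
  · simp [hM.cos_zero, hM.sin_zero]
  · convert hM.hasDerivAt_exp x (r⁻¹ • v) r 0 using 1
    simp [hM.cos_zero, hM.sin_zero, smul_smul, mul_inv_cancel₀ hr0.ne']

theorem mem_tangentVectors (hM : IsSpaceForm M B ε C S) {x v : E} (hx : x ∈ M.carrier) :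
    v ∈ tangentVectors M x ↔ ε * B x v = 0 := by
  constructor
  · rintro ⟨c, hc, hmem, rfl, rfl⟩
    exact hM.tangent_of_hasDerivAt (hc.differentiable (by simp) 0).hasDerivAt
      (Eventually.of_forall hmem)
  · intro hv
    obtain ⟨c, hc, hmem, h0, hd⟩ := hM.exists_curve hx hv
    exact ⟨c, hc, hmem, h0, hd.deriv⟩

/-- The normal space of the quadric at `x` is spanned by `x`. Since the ambient form may be
indefinite, uniqueness of the projection rests on its positivity on tangent vectors. -/
theorem tangentialPart_eq (hM : IsSpaceForm M B ε C S) {x : E} (hx : x ∈ M.carrier) (w : E) :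
    tangentialPart M x w = w - (ε * B x w) • x := by
  have key : IsTangentialPart M x w (w - (ε * B x w) • x) := by
    refine ⟨(hM.mem_tangentVectors hx).2 ?_, fun y hy => ?_⟩
    · simp only [map_sub, map_smul, smul_eq_mul]
      linear_combination (-ε * B x w) * hM.self x hx - B x w * hM.cube
    · rw [hM.mem_tangentVectors hx] at hy
      rw [hM.form_eq, sub_sub_cancel]
      simp only [map_smul, smul_eq_mul, smul_apply]
      linear_combination B x w * hy
  have hex : ∃ v, IsTangentialPart M x w v := ⟨_, key⟩
  rw [tangentialPart, dif_pos hex]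
  have hch := hex.choose_spec
  set v := hex.choose
  set v' := w - (ε * B x w) • x
  -- The difference of two projections is tangent and orthogonal to every tangent vector, hence to
  -- itself, against positivity.
  by_contra hne
  have ht := (hM.mem_tangentVectors hx).1 hch.1
  have ht' := (hM.mem_tangentVectors hx).1 key.1
  have hsub : ε * B x (v - v') = 0 := by
    rw [map_sub]
    linear_combination ht - ht'
  have h1 := hch.2 _ ((hM.mem_tangentVectors hx).2 hsub)
  have h2 := key.2 _ ((hM.mem_tangentVectors hx).2 hsub)
  rw [hM.form_eq] at h1 h2
  have h3 := hM.pos x hx _ hsub (sub_ne_zero.2 hne)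
  have h4 : B (v - v') (v - v') = B (w - v') (v - v') - B (w - v) (v - v') := by
    simp only [map_sub, sub_apply]
    ring
  linarith

/-- Differentiating `ε⟨c, c'⟩ = 0` shows that the normal component of `c''` is determined by the
speed, for curves of arbitrary speed. This generality is needed because the curves of a variation
need not have unit speed. -/
theorem tension_eq (hM : IsSpaceForm M B ε C S) {I : Set ℝ} (hI : IsOpen I) {c c₁ c₂ : ℝ → E}
    (hmem : ∀ s ∈ I, c s ∈ M.carrier) (hc : ∀ s ∈ I, HasDerivAt c (c₁ s) s)
    (hc₁ : ∀ s ∈ I, HasDerivAt c₁ (c₂ s) s) {s : ℝ} (hs : s ∈ I) :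
    ε * B (c s) (c₂ s) = -ε * B (c₁ s) (c₁ s) ∧
    tension M c s = c₂ s + (ε * B (c₁ s) (c₁ s)) • c s := by
  have ev : ∀ᶠ t in 𝓝 s, t ∈ I := hI.mem_nhds hs
  have hd : deriv c =ᶠ[𝓝 s] c₁ := ev.mono fun t ht => (hc t ht).deriv
  have h1 : HasDerivAt (fun t => ε * B (c t) (c₁ t)) (ε * (B (c s) (c₂ s) + B (c₁ s) (c₁ s))) s :=
    ((hc s hs).bilin (hc₁ s hs)).const_mul ε
  have h2 : HasDerivAt (fun t => ε * B (c t) (c₁ t)) 0 s := by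
    refine (hasDerivAt_const s (0 : ℝ)).congr_of_eventuallyEq (ev.mono fun t ht => ?_)
    exact hM.tangent_of_hasDerivAt (hc t ht) (eventually_of_mem (hI.mem_nhds ht) hmem)
  have h3 : ε * B (c s) (c₂ s) = -ε * B (c₁ s) (c₁ s) := by linarith [h1.unique h2]
  refine ⟨h3, ?_⟩
  rw [tension, covDerivAlong, hd.deriv_eq, (hc₁ s hs).deriv, hM.tangentialPart_eq (hmem s hs), h3]
  module

theorem form_tension (hM : IsSpaceForm M B ε C S) {I : Set ℝ} (hI : IsOpen I) {c c₁ c₂ : ℝ → E}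
    (hmem : ∀ s ∈ I, c s ∈ M.carrier) (hc : ∀ s ∈ I, HasDerivAt c (c₁ s) s)
    (hc₁ : ∀ s ∈ I, HasDerivAt c₁ (c₂ s) s) {s : ℝ} (hs : s ∈ I) :
    M.form (tension M c s) (tension M c s) = B (c₂ s) (c₂ s) - ε * B (c₁ s) (c₁ s) ^ 2 := by
  obtain ⟨h1, h2⟩ := hM.tension_eq hI hmem hc hc₁ hs
  rw [h2, hM.form_eq]
  simp only [map_add, map_smul, smul_eq_mul, smul_apply,
    add_apply]
  rw [hM.symm (c₂ s) (c s)]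
  linear_combination 2 * B (c₁ s) (c₁ s) * h1 + ε * B (c₁ s) (c₁ s) ^ 2 * hM.self _ (hmem s hs)
    + B (c₁ s) (c₁ s) ^ 2 * hM.cube

end IsSpaceForm

/-- `c` is a unit speed curve in a totally geodesic surface of the space form `M`, with unit tangent
`T`, unit normal `N` and signed curvature `κ`. -/
structure IsFrenetCurve (M : EmbeddedSpace E) (B : E →L[ℝ] E →L[ℝ] ℝ) (ε : ℝ) (I : Set ℝ)
    (c T N : ℝ → E) (κ : ℝ → ℝ) : Prop where
  mem : ∀ s ∈ I, c s ∈ M.carrier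
  hasDerivAt : ∀ s ∈ I, HasDerivAt c (T s) s
  hasDerivAt_tangent : ∀ s ∈ I, HasDerivAt T (κ s • N s - ε • c s) s
  hasDerivAt_normal : ∀ s ∈ I, HasDerivAt N (-κ s • T s) s
  tangent_tangent : ∀ s ∈ I, B (T s) (T s) = 1
  normal_normal : ∀ s ∈ I, B (N s) (N s) = 1
  tangent_normal : ∀ s ∈ I, B (T s) (N s) = 0

namespace IsFrenetCurve

variable {M : EmbeddedSpace E} {B : E →L[ℝ] E →L[ℝ] ℝ} {ε : ℝ} {C S : ℝ → ℝ} {I : Set ℝ}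
  {c T N : ℝ → E} {κ : ℝ → ℝ}

/-- The Frenet equations are a linear system with smooth coefficient `κ`, so regularity bootstraps:
if `c`, `T`, `N` are `C^n`, so are their derivatives. Hence the coordinate functions need only be
assumed twice differentiable. -/
theorem smooth (hc : IsFrenetCurve M B ε I c T N κ) (hI : IsOpen I) (hκ : ContDiffOn ℝ ∞ κ I) :
    ContDiffOn ℝ ∞ c I ∧ ContDiffOn ℝ ∞ T I ∧ ContDiffOn ℝ ∞ N I := by
  have hstep : ∀ {n : ℕ} {u u' : ℝ → E}, (∀ s ∈ I, HasDerivAt u (u' s) s) →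
      ContDiffOn ℝ n u' I → ContDiffOn ℝ (n + 1 : ℕ) u I := by
    intro n u u' hu hu'
    push_cast
    refine (contDiffOn_succ_iff_deriv_of_isOpen hI).2
      ⟨fun s hs => (hu s hs).differentiableAt.differentiableWithinAt, by simp, ?_⟩
    exact hu'.congr fun s hs => (hu s hs).deriv
  have main : ∀ n : ℕ, ContDiffOn ℝ n c I ∧ ContDiffOn ℝ n T I ∧ ContDiffOn ℝ n N I := by
    intro n
    induction n with
    | zero =>
      simp only [Nat.cast_zero, contDiffOn_zero]
      exact ⟨fun s hs => (hc.hasDerivAt s hs).continuousAt.continuousWithinAt,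
        fun s hs => (hc.hasDerivAt_tangent s hs).continuousAt.continuousWithinAt,
        fun s hs => (hc.hasDerivAt_normal s hs).continuousAt.continuousWithinAt⟩
    | succ n ih =>
      obtain ⟨h1, h2, h3⟩ := ih
      have hκn : ContDiffOn ℝ n κ I := hκ.of_le (mod_cast le_top)
      exact ⟨hstep hc.hasDerivAt h2,
        hstep hc.hasDerivAt_tangent ((hκn.smul h3).sub (contDiffOn_const.smul h1)),
        hstep hc.hasDerivAt_normal (hκn.neg.smul h2)⟩
  exact ⟨contDiffOn_infty.2 fun n => (main n).1, contDiffOn_infty.2 fun n => (main n).2.1,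
    contDiffOn_infty.2 fun n => (main n).2.2⟩

theorem tension_eq (hc : IsFrenetCurve M B ε I c T N κ) (hM : IsSpaceForm M B ε C S)
    (hI : IsOpen I) {s : ℝ} (hs : s ∈ I) : tension M c s = κ s • N s := by
  rw [(hM.tension_eq hI hc.mem hc.hasDerivAt hc.hasDerivAt_tangent hs).2, hc.tangent_tangent s hs]
  module

theorem geodesicCurvature_eq (hc : IsFrenetCurve M B ε I c T N κ) (hM : IsSpaceForm M B ε C S)
    (hI : IsOpen I) {s : ℝ} (hs : s ∈ I) : geodesicCurvature M c s = |κ s| := by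
  rw [geodesicCurvature, hc.tension_eq hM hI hs, hM.form_eq]
  simp only [map_smul, smul_eq_mul, smul_apply, hc.normal_normal s hs]
  rw [mul_one, Real.sqrt_mul_self_eq_abs]

theorem isUnitSpeedCurve (hc : IsFrenetCurve M B ε I c T N κ) (hM : IsSpaceForm M B ε C S)
    (hI : IsOpen I) (hκ : ContDiffOn ℝ ∞ κ I) : IsUnitSpeedCurve M I c where
  smooth := (hc.smooth hI hκ).1
  mem := hc.mem
  unit s hs := by rw [(hc.hasDerivAt s hs).deriv, hM.form_eq, hc.tangent_tangent s hs]

end IsFrenetCurve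

end SpaceForms

/-! ### The first variation formula. -/

section FirstVariation

variable {E : Type*} [NormedAddCommGroup E] [NormedSpace ℝ E]
  {M : EmbeddedSpace E} {B : E →L[ℝ] E →L[ℝ] ℝ} {ε : ℝ} {C S : ℝ → ℝ} {I : Set ℝ}
  {c T N : ℝ → E} {κ f : ℝ → ℝ} {p q δ : ℝ} {F : ℝ × ℝ → E}

theorem fBienergy_eq_integral (hM : IsSpaceForm M B ε C S) (hI : IsOpen I) (hpq : p ≤ q)
    (hsub : Icc p q ⊆ I) (hF : ContDiffOn ℝ ∞ F (Ioo (-δ) δ ×ˢ I))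
    (hmem : ∀ t ∈ Ioo (-δ) δ, ∀ s ∈ I, F (t, s) ∈ M.carrier) {t : ℝ} (ht : t ∈ Ioo (-δ) δ) :
    fBienergy M f (fun s => F (t, s)) p q = ∫ s in p..q, f s *
      (B (dirDeriv (0, 1) (dirDeriv (0, 1) F) (t, s)) (dirDeriv (0, 1) (dirDeriv (0, 1) F) (t, s))
        - ε * B (dirDeriv (0, 1) F (t, s)) (dirDeriv (0, 1) F (t, s)) ^ 2) := by
  have hU : IsOpen (Ioo (-δ) δ ×ˢ I) := isOpen_Ioo.prod hI
  refine intervalIntegral.integral_congr fun s hs => ?_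
  rw [uIcc_of_le hpq] at hs
  rw [hM.form_tension hI (c := fun s => F (t, s)) (c₁ := fun s => dirDeriv (0, 1) F (t, s))
    (c₂ := fun s => dirDeriv (0, 1) (dirDeriv (0, 1) F) (t, s)) (hmem t ht)
    (fun s hs => hasDerivAt_slice_right hF hU ⟨ht, hs⟩)
    (fun s hs => hasDerivAt_slice_right (hF.dirDeriv hU (0, 1)) hU ⟨ht, hs⟩) (hsub hs)]

/-- The variation field of a variation is tangent to the space form and vanishes near the
boundary. -/
theorem IsVariation.field (hM : IsSpaceForm M B ε C S) (hI : IsOpen I) (hδ : 0 < δ)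
    (hF : IsVariation M I c p q δ F) (hp : p ∈ I) (hq : q ∈ I) :
    (∀ s ∈ I, ε * B (c s) (dirDeriv (1, 0) F (0, s)) = 0) ∧
    (dirDeriv (1, 0) F (0, p) = 0 ∧ dirDeriv (0, 1) (dirDeriv (1, 0) F) (0, p) = 0) ∧
    (dirDeriv (1, 0) F (0, q) = 0 ∧ dirDeriv (0, 1) (dirDeriv (1, 0) F) (0, q) = 0) := by
  have hU : IsOpen (Ioo (-δ) δ ×ˢ I) := isOpen_Ioo.prod hI
  have h0 : (0 : ℝ) ∈ Ioo (-δ) δ := ⟨by linarith, hδ⟩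
  have ev0 : ∀ᶠ t in 𝓝 (0 : ℝ), t ∈ Ioo (-δ) δ := Ioo_mem_nhds h0.1 h0.2
  -- Since `p < p'` and `q' < q`, both endpoints have neighbourhoods free of the support, so the
  -- field vanishes there together with its derivative.
  obtain ⟨p', q', hp', hq', hsupp⟩ := hF.support
  have vanish : ∀ s ∈ I, s ∉ Icc p' q' → dirDeriv (1, 0) F (0, s) = 0 := fun s hs hns =>
    (hasDerivAt_slice_left hF.smooth hU ⟨h0, hs⟩).unique
      ((hasDerivAt_const 0 (c s)).congr_of_eventuallyEq (ev0.mono fun t ht => hsupp t ht s hs hns))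
  have bdry : ∀ s₀ ∈ I, s₀ ∉ Icc p' q' → dirDeriv (1, 0) F (0, s₀) = 0 ∧
      dirDeriv (0, 1) (dirDeriv (1, 0) F) (0, s₀) = 0 := by
    intro s₀ hs₀ hns
    refine ⟨vanish s₀ hs₀ hns, ?_⟩
    refine (hasDerivAt_slice_right (hF.smooth.dirDeriv hU (1, 0)) hU ⟨h0, hs₀⟩).unique
      ((hasDerivAt_const s₀ (0 : E)).congr_of_eventuallyEq ?_)
    filter_upwards [hI.mem_nhds hs₀, isClosed_Icc.isOpen_compl.mem_nhds hns] with s hs hs'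
    exact vanish s hs hs'
  refine ⟨fun s hs => ?_, bdry p hp fun h => absurd h.1 (by linarith),
    bdry q hq fun h => absurd h.2 (by linarith)⟩
  have := hM.tangent_of_hasDerivAt (hasDerivAt_slice_left hF.smooth hU ⟨h0, hs⟩)
    (ev0.mono fun t ht => hF.mem t ht s hs)
  rwa [hF.initial s hs] at this

/-- The first variation formula for the `f`-bienergy in terms of the Frenet frame. -/
theorem IsFrenetCurve.hasDerivAt_fBienergy (hc : IsFrenetCurve M B ε I c T N κ)
    (hM : IsSpaceForm M B ε C S) (hI : IsOpen I) (hκ : ContDiffOn ℝ ∞ κ I)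
    (hf : ContDiffOn ℝ ∞ f I) {g g₁ g₂ κ₁ : ℝ → ℝ} (hg : ∀ s ∈ I, g s = f s * κ s)
    (hg₁ : ∀ s ∈ I, HasDerivAt g (g₁ s) s) (hg₂ : ∀ s ∈ I, HasDerivAt g₁ (g₂ s) s)
    (hκ₁ : ∀ s ∈ I, HasDerivAt κ (κ₁ s) s) (hg₂c : ContinuousOn g₂ I) (hκ₁c : ContinuousOn κ₁ I)
    (hp : p ∈ I) (hq : q ∈ I) (hpq : p ≤ q) (hsub : Icc p q ⊆ I) (hδ : 0 < δ)
    (hF : IsVariation M I c p q δ F) :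
    HasDerivAt (fun t => fBienergy M f (fun s => F (t, s)) p q)
      (∫ s in p..q, 2 * ((g₂ s - g s * κ s ^ 2 + ε * g s) * B (dirDeriv (1, 0) F (0, s)) (N s)
        - (2 * g₁ s * κ s + g s * κ₁ s) * B (dirDeriv (1, 0) F (0, s)) (T s))) 0 := by
  have hU : IsOpen (Ioo (-δ) δ ×ˢ I) := isOpen_Ioo.prod hI
  have h0 : (0 : ℝ) ∈ Ioo (-δ) δ := ⟨by linarith, hδ⟩
  have ev0 : ∀ᶠ t in 𝓝 (0 : ℝ), t ∈ Ioo (-δ) δ := Ioo_mem_nhds h0.1 h0.2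
  obtain ⟨hcs, hTs, hNs⟩ := hc.smooth hI hκ
  obtain ⟨htan, ⟨hVp, hVp'⟩, ⟨hVq, hVq'⟩⟩ := hF.field hM hI hδ hp hq
  set D := dirDeriv (0, 1) F with hD
  set D₂ := dirDeriv (0, 1) D with hD₂
  set W := dirDeriv (1, 0) F with hW
  set W₁ := dirDeriv (0, 1) W with hW₁
  set W₂ := dirDeriv (0, 1) W₁ with hW₂
  have sD : ContDiffOn ℝ ∞ D _ := hF.smooth.dirDeriv hU _
  have sD₂ : ContDiffOn ℝ ∞ D₂ _ := sD.dirDeriv hU _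
  have sW : ContDiffOn ℝ ∞ W _ := hF.smooth.dirDeriv hU _
  have sW₁ : ContDiffOn ℝ ∞ W₁ _ := sW.dirDeriv hU _
  set G : ℝ × ℝ → ℝ := fun x => f x.2 * (B (D₂ x) (D₂ x) - ε * B (D x) (D x) ^ 2) with hG
  have sG : ContDiffOn ℝ ∞ G (Ioo (-δ) δ ×ˢ I) :=
    (hf.comp contDiffOn_snd fun x hx => hx.2).mul
      ((sD₂.bilin sD₂).sub (contDiffOn_const.mul ((sD.bilin sD).pow 2)))
  have hderiv := hasDerivAt_intervalIntegral_of_contDiffOn hI hδ hpq hsub sG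
  have hE : (fun t => fBienergy M f (fun s => F (t, s)) p q) =ᶠ[𝓝 0]
      fun t => ∫ s in p..q, G (t, s) :=
    ev0.mono fun t ht => fBienergy_eq_integral hM hI hpq hsub hF.smooth hF.mem ht
  refine (hderiv.congr_of_eventuallyEq hE).congr_deriv ?_
  -- derivatives along the curve
  have dV : ∀ s ∈ I, HasDerivAt (fun s => W (0, s)) (W₁ (0, s)) s := fun s hs =>
    hasDerivAt_slice_right sW hU ⟨h0, hs⟩
  have dV₁ : ∀ s ∈ I, HasDerivAt (fun s => W₁ (0, s)) (W₂ (0, s)) s := fun s hs =>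
    hasDerivAt_slice_right sW₁ hU ⟨h0, hs⟩
  have D_eq : ∀ s ∈ I, D (0, s) = T s := fun s hs =>
    (hasDerivAt_slice_right hF.smooth hU ⟨h0, hs⟩).unique ((hc.hasDerivAt s hs).congr_of_eventuallyEq
      (eventually_of_mem (hI.mem_nhds hs) hF.initial))
  have D₂_eq : ∀ s ∈ I, D₂ (0, s) = κ s • N s - ε • c s := fun s hs =>
    (hasDerivAt_slice_right sD hU ⟨h0, hs⟩).unique
      ((hc.hasDerivAt_tangent s hs).congr_of_eventuallyEq
        (eventually_of_mem (hI.mem_nhds hs) D_eq))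
  have DW : ∀ x ∈ Ioo (-δ) δ ×ˢ I, dirDeriv (1, 0) D x = W₁ x := fun x hx =>
    dirDeriv_comm hF.smooth hU _ _ hx
  have D₂W : ∀ x ∈ Ioo (-δ) δ ×ˢ I, dirDeriv (1, 0) D₂ x = W₂ x := fun x hx =>
    (dirDeriv_comm sD hU _ _ hx).trans (dirDeriv_congr hU DW _ hx)
  have zero_deriv : ∀ {u u' : ℝ → ℝ}, (∀ s ∈ I, u s = 0) → (∀ s ∈ I, HasDerivAt u (u' s) s) →
      ∀ s ∈ I, u' s = 0 := fun hu hu' s hs =>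
    (hu' s hs).unique ((hasDerivAt_const s (0 : ℝ)).congr_of_eventuallyEq
      (eventually_of_mem (hI.mem_nhds hs) hu))
  -- The tangency `ε⟨c, W⟩ = 0` is differentiated twice along the curve; this eliminates `⟨c, W''⟩`
  -- below.
  have tan₁ := zero_deriv htan fun s hs => ((hc.hasDerivAt s hs).bilin (dV s hs)).const_mul ε
  have tan₂ := zero_deriv tan₁ fun s hs => (((hc.hasDerivAt s hs).bilin (dV₁ s hs)).add
    ((hc.hasDerivAt_tangent s hs).bilin (dV s hs))).const_mul ε
  -- The raw derivative is `f(2⟨W'', κN - εc⟩ - 4ε⟨W', T⟩)`. By the twice differentiated tangency,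
  -- the terms in `⟨W', T⟩` cancel and only normal components remain.
  have dG : ∀ s ∈ I, dirDeriv (1, 0) G (0, s) =
      2 * g s * (B (W₂ (0, s)) (N s) + ε * B (W (0, s)) (N s)) := by
    intro s hs
    have a := hasDerivAt_slice_left sD₂ hU (t := 0) ⟨h0, hs⟩
    have b := hasDerivAt_slice_left sD hU (t := 0) ⟨h0, hs⟩
    have h := ((a.bilin (B := B) a).fun_sub
      (((b.bilin (B := B) b).fun_pow 2).const_mul ε)).const_mul (f s)
    rw [(hasDerivAt_slice_left sG hU ⟨h0, hs⟩).unique h, DW _ ⟨h0, hs⟩, D₂W _ ⟨h0, hs⟩,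
      D_eq s hs, D₂_eq s hs, hc.tangent_tangent s hs, hg s hs]
    have h2 := tan₂ s hs
    have h1 := htan s hs
    simp only [map_sub, map_smul, smul_eq_mul, smul_apply, sub_apply] at h2 ⊢
    rw [hM.symm (N s)] at h2
    rw [hM.symm (N s), hM.symm (W₂ (0, s)) (c s), hM.symm (W₁ (0, s)) (T s)]
    norm_num
    linear_combination (-2 * f s) * h2 - 2 * f s * ε * h1
  -- integration by parts
  set P : ℝ → ℝ := fun s => 2 * (g s * B (W₁ (0, s)) (N s)
    - B (W (0, s)) (g₁ s • N s - (g s * κ s) • T s)) with hP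
  set R : ℝ → ℝ := fun s => 2 * ((g₂ s - g s * κ s ^ 2 + ε * g s) * B (W (0, s)) (N s)
        - (2 * g₁ s * κ s + g s * κ₁ s) * B (W (0, s)) (T s)) with hR
  -- `P` is twice the boundary term `g⟨W', N⟩ - ⟨W, (gN)'⟩`, whose derivative is `g⟨W'', N⟩ - ⟨W,
  -- (gN)''⟩`. The Frenet equations give `(gN)'' = (g'' - gκ²)N - (2g'κ + gκ')T + εgκc`, and the
  -- last term is orthogonal to `W`.
  have dP : ∀ s ∈ I, HasDerivAt P (dirDeriv (1, 0) G (0, s) - R s) s := by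
    intro s hs
    have h := (((hg₁ s hs).fun_mul ((dV₁ s hs).bilin (B := B) (hc.hasDerivAt_normal s hs))).fun_sub
      ((dV s hs).bilin (B := B) (((hg₂ s hs).fun_smul (hc.hasDerivAt_normal s hs)).fun_sub
        (((hg₁ s hs).fun_mul (hκ₁ s hs)).fun_smul (hc.hasDerivAt_tangent s hs))))).const_mul 2
    refine h.congr_deriv ?_
    rw [dG s hs]
    have h1 := htan s hs
    rw [hM.symm] at h1
    simp only [hR, map_sub, map_add, map_smul, smul_eq_mul]
    linear_combination (-2 * g s * κ s) * h1
  have contV : ∀ {H : ℝ × ℝ → E}, ContDiffOn ℝ ∞ H (Ioo (-δ) δ ×ˢ I) →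
      ContinuousOn (fun s => H (0, s)) I := fun hH =>
    hH.continuousOn.comp (by fun_prop) fun s hs => ⟨h0, hs⟩
  have cg : ContinuousOn g I := fun s hs => (hg₁ s hs).continuousAt.continuousWithinAt
  have cg₁ : ContinuousOn g₁ I := fun s hs => (hg₂ s hs).continuousAt.continuousWithinAt
  have cN := (contV sW).bilin (B := B) hNs.continuousOn
  have cT := (contV sW).bilin (B := B) hTs.continuousOn
  have cκ := hκ.continuousOn
  have cR : ContinuousOn R I :=
    continuousOn_const.mul ((((hg₂c.sub (cg.mul (cκ.pow 2))).add (continuousOn_const.mul cg)).mul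
      cN).sub ((((continuousOn_const.mul cg₁).mul cκ).add (cg.mul hκ₁c)).mul cT))
  have cG : ContinuousOn (fun s => dirDeriv (1, 0) G (0, s)) I :=
    (sG.dirDeriv hU (1, 0)).continuousOn.comp (by fun_prop) fun s hs => ⟨h0, hs⟩
  have hsub' : uIcc p q ⊆ I := by rwa [uIcc_of_le hpq]
  have iR := (cR.mono hsub').intervalIntegrable (μ := volume)
  have iG := (cG.mono hsub').intervalIntegrable (μ := volume)
  have key := intervalIntegral.integral_eq_sub_of_hasDerivAt (fun s hs => dP s (hsub' hs))
    (iG.sub iR)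
  rw [intervalIntegral.integral_sub iG iR] at key
  have hPp : P p = 0 := by simp [hP, hVp, hVp']
  have hPq : P q = 0 := by simp [hP, hVq, hVq']
  rw [hPp, hPq] at key
  linarith

end FirstVariation

/-! ### Criteria for being `f`-biharmonic and for not being biharmonic. -/

section FBiharmonic

variable {E : Type*} [NormedAddCommGroup E] [NormedSpace ℝ E]
  {M : EmbeddedSpace E} {B : E →L[ℝ] E →L[ℝ] ℝ} {ε : ℝ} {C S : ℝ → ℝ} {I : Set ℝ}
  {c T N : ℝ → E} {κ : ℝ → ℝ} {p q δ : ℝ}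

theorem bienergy_eq_fBienergy (M : EmbeddedSpace E) (c : ℝ → E) (p q : ℝ) :
    bienergy M c p q = fBienergy M (fun _ => 1 / 2) c p q := by
  rw [bienergy, fBienergy, intervalIntegral.integral_const_mul]

/-- Moving each point of a Frenet curve along the geodesic in the direction of the tangent. -/
theorem IsFrenetCurve.isVariation_tangent (hc : IsFrenetCurve M B ε I c T N κ)
    (hM : IsSpaceForm M B ε C S) (hI : IsOpen I) (hκ : ContDiffOn ℝ ∞ κ I) {η : ℝ → ℝ}
    (hη : ContDiff ℝ ∞ η) {p' q' : ℝ} (hp : p < p') (hq : q' < q)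
    (hsupp : ∀ s, s ∉ Icc p' q' → η s = 0) :
    IsVariation M I c p q δ
      (fun x => C (η x.2 * x.1) • c x.2 + S (η x.2 * x.1) • T x.2) := by
  obtain ⟨hcs, hTs, -⟩ := hc.smooth hI hκ
  have harg : ContDiff ℝ ∞ fun x : ℝ × ℝ => η x.2 * x.1 :=
    (hη.comp contDiff_snd).mul contDiff_fst
  refine ⟨?_, fun t _ s hs => ?_, fun s _ => ?_, p', q', hp, hq, fun t _ s _ hns => ?_⟩
  · exact ((hM.smooth_cos.comp harg).contDiffOn.smul
      (hcs.comp contDiffOn_snd fun x hx => hx.2)).add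
      ((hM.smooth_sin.comp harg).contDiffOn.smul (hTs.comp contDiffOn_snd fun x hx => hx.2))
  · exact hM.exp_mem _ (hc.mem s hs) _ (hM.tangent_of_hasDerivAt (hc.hasDerivAt s hs)
      (eventually_of_mem (hI.mem_nhds hs) hc.mem)) (hc.tangent_tangent s hs) _
  · simp [hM.cos_zero, hM.sin_zero]
  · simp [hsupp s hns, hM.cos_zero, hM.sin_zero]

/-- For `f = 1/2` one has `g = κ/2`, and the tangential coefficient `-2(2g'κ + gκ')` equals `-3κκ'`.
The variation field is `ηT`, so the normal part drops out. -/
theorem IsFrenetCurve.hasDerivAt_bienergy_tangent (hc : IsFrenetCurve M B ε I c T N κ)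
    (hM : IsSpaceForm M B ε C S) (hI : IsOpen I) (hκ : ContDiffOn ℝ ∞ κ I) {κ₁ : ℝ → ℝ}
    (hκ₁ : ∀ s ∈ I, HasDerivAt κ (κ₁ s) s) {η : ℝ → ℝ} (hη : ContDiff ℝ ∞ η) {p' q' : ℝ}
    (hp : p < p') (hq : q' < q) (hsupp : ∀ s, s ∉ Icc p' q' → η s = 0)
    (hpI : p ∈ I) (hqI : q ∈ I) (hpq : p ≤ q) (hsub : Icc p q ⊆ I) (hδ : 0 < δ) :
    HasDerivAt (fun t => bienergy M
      (fun s => C (η s * t) • c s + S (η s * t) • T s) p q)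
      (∫ s in p..q, -3 * (η s * (κ s * κ₁ s))) 0 := by
  have hU : IsOpen (Ioo (-δ) δ ×ˢ I) := isOpen_Ioo.prod hI
  have hF := hc.isVariation_tangent hM hI hκ (δ := δ) hη hp hq hsupp
  have hκd : ContDiffOn ℝ ∞ κ₁ I :=
    (hκ.deriv_of_isOpen hI (m := ∞) (by simp)).congr fun s hs => (hκ₁ s hs).deriv.symm
  have hκ₂ : ∀ s ∈ I, HasDerivAt κ₁ (deriv κ₁ s) s := fun s hs =>
    ((hκd.contDiffAt (hI.mem_nhds hs)).differentiableAt (by simp)).hasDerivAt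
  have hκ₂c : ContinuousOn (deriv κ₁) I := hκd.continuousOn_deriv_of_isOpen hI (by simp)
  have key := hc.hasDerivAt_fBienergy hM hI hκ (f := fun _ => 1 / 2) contDiffOn_const
    (g := fun s => 1 / 2 * κ s) (fun _ _ => rfl) (fun s hs => (hκ₁ s hs).const_mul (1 / 2))
    (fun s hs => (hκ₂ s hs).const_mul (1 / 2)) hκ₁ (continuousOn_const.mul hκ₂c)
    hκd.continuousOn hpI hqI hpq hsub hδ hF
  simp only [bienergy_eq_fBienergy]
  refine key.congr_deriv (intervalIntegral.integral_congr fun s hs => ?_)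
  rw [uIcc_of_le hpq] at hs
  have hs := hsub hs
  have hV : dirDeriv (1, 0) (fun x : ℝ × ℝ => C (η x.2 * x.1) • c x.2 + S (η x.2 * x.1) • T x.2)
      (0, s) = η s • T s := by
    refine (hasDerivAt_slice_left hF.smooth hU ⟨⟨by linarith, hδ⟩, hs⟩).unique
      ((hM.hasDerivAt_exp (c s) (T s) (η s) 0).congr_deriv ?_)
    simp [hM.cos_zero, hM.sin_zero]
  simp only [hV, map_smul, smul_apply, smul_eq_mul, hc.tangent_tangent s hs,
    hc.tangent_normal s hs]
  ring

/-- Sliding the curve along its tangents by `η = χh`, with `χ` a bump function at `s₀`, changes the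
bienergy at the rate `-3∫ χhκκ'`. The factor `h` serves to fix the sign of the integrand, which
makes this negative. -/
theorem IsFrenetCurve.not_isBiharmonicCurve (hc : IsFrenetCurve M B ε I c T N κ)
    (hM : IsSpaceForm M B ε C S) (hI : IsOpen I) (hconn : I.OrdConnected)
    (hκ : ContDiffOn ℝ ∞ κ I) {κ₁ h : ℝ → ℝ} (hκ₁ : ∀ s ∈ I, HasDerivAt κ (κ₁ s) s)
    (hh : ContDiff ℝ ∞ h) (hpos : ∀ s ∈ I, 0 ≤ h s * (κ s * κ₁ s)) {s₀ : ℝ} (hs₀ : s₀ ∈ I)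
    (hpos₀ : 0 < h s₀ * (κ s₀ * κ₁ s₀)) : ¬ IsBiharmonicCurve M I c := by
  intro hbi
  obtain ⟨r, hr, hball⟩ := Metric.isOpen_iff.1 hI s₀ hs₀
  rw [Real.ball_eq_Ioo] at hball
  have hp : s₀ - r / 2 ∈ I := hball ⟨by linarith, by linarith⟩
  have hq : s₀ + r / 2 ∈ I := hball ⟨by linarith, by linarith⟩
  have hsub := hconn.out hp hq
  obtain ⟨χ, hχs, -, hχ, hχr, hχ₀⟩ := exists_contDiff_tsupport_subset (n := ⊤)
    (Icc_mem_nhds (show s₀ - r / 4 < s₀ by linarith) (show s₀ < s₀ + r / 4 by linarith))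
  have hη : ContDiff ℝ ∞ fun s => χ s * h s := hχ.mul hh
  have hsupp : ∀ s, s ∉ Icc (s₀ - r / 4) (s₀ + r / 4) → χ s * h s = 0 := fun s hs => by
    rw [image_eq_zero_of_notMem_tsupport fun h => hs (hχs h), zero_mul]
  have hd := hc.hasDerivAt_bienergy_tangent hM hI hκ hκ₁ hη
    (show s₀ - r / 2 < s₀ - r / 4 by linarith) (show s₀ + r / 4 < s₀ + r / 2 by linarith) hsupp
    hp hq (by linarith) hsub one_pos
  have hd' := hbi.critical _ hp _ hq (by linarith) 1 one_pos _ (hc.isVariation_tangent hM hI hκ hη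
    (show s₀ - r / 2 < s₀ - r / 4 by linarith) (show s₀ + r / 4 < s₀ + r / 2 by linarith) hsupp)
  have hz := hd.unique hd'
  rw [intervalIntegral.integral_const_mul] at hz
  have hκ₁c : ContinuousOn κ₁ I :=
    (hκ.continuousOn_deriv_of_isOpen hI (by simp)).congr fun s hs => (hκ₁ s hs).deriv.symm
  have hgt : 0 < ∫ s in (s₀ - r / 2)..(s₀ + r / 2), χ s * h s * (κ s * κ₁ s) := by
    refine intervalIntegral.integral_pos (by linarith) ?_ (fun s hs => ?_)
      ⟨s₀, ⟨by linarith, by linarith⟩, ?_⟩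
    · exact ((hη.continuous.continuousOn.mul (hκ.continuousOn.mul hκ₁c)).mono hsub)
    · rw [mul_assoc]
      exact mul_nonneg (hχr ⟨s, rfl⟩).1 (hpos s (hsub (Ioc_subset_Icc_self hs)))
    · rwa [hχ₀, one_mul]
  linarith

/-- A Frenet curve of curvature `1 / w` is proper `f`-biharmonic for `f = c₁ w ^ (3 / 2)` if `w`
solves the second order equation `2 w w'' - w' ^ 2 = 4 - 4 ε w ^ 2` and is not constant. -/
theorem IsFrenetCurve.isProperFBiharmonicCurve (hc : IsFrenetCurve M B ε I c T N κ)
    (hM : IsSpaceForm M B ε C S) (hI : IsOpen I) (hconn : I.OrdConnected)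
    {w w₁ w₂ f : ℝ → ℝ} {c₁ : ℝ} (hc₁ : 0 < c₁) (hw : ContDiff ℝ ∞ w)
    (hw₁ : ∀ s, HasDerivAt w (w₁ s) s) (hw₂ : ∀ s, HasDerivAt w₁ (w₂ s) s) (hpos : ∀ s, 0 < w s)
    (hode : ∀ s, 2 * w s * w₂ s - w₁ s ^ 2 = 4 - 4 * ε * w s ^ 2)
    (hκw : ∀ s, κ s = 1 / w s) (hf : ∀ s, f s = c₁ * w s ^ ((3 : ℝ) / 2))
    (hne : ∃ s ∈ I, w₁ s ≠ 0) :
    IsProperFBiharmonicCurve M I f c ∧ ∀ s ∈ I, geodesicCurvature M c s = κ s ∧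
      f s = c₁ * κ s ^ (-(3 : ℝ) / 2) := by
  obtain rfl : κ = fun s => 1 / w s := funext hκw
  have hκs : ContDiff ℝ ∞ fun s => 1 / w s := contDiff_const.div hw fun s => (hpos s).ne'
  have hdw : deriv w = w₁ := funext fun s => (hw₁ s).deriv
  have hw₁s : ContDiff ℝ ∞ w₁ := hdw ▸ ((contDiff_infty_iff_deriv.1 hw).2)
  have hdw₁ : deriv w₁ = w₂ := funext fun s => (hw₂ s).deriv
  have hw₂c : Continuous w₂ := hdw₁ ▸ ((contDiff_infty_iff_deriv.1 hw₁s).2.continuous)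
  -- As the cube of a square root, the weight is visibly smooth, and the equations below become
  -- rational in `√w`.
  have hf3 : ∀ s, w s ^ ((3 : ℝ) / 2) = √(w s) ^ 3 := fun s => by
    rw [Real.sqrt_eq_rpow, ← Real.rpow_natCast, ← Real.rpow_mul (hpos s).le]
    norm_num
  have hfs : ContDiff ℝ ∞ f := by
    rw [funext hf]
    simp only [hf3]
    exact contDiff_const.mul ((hw.sqrt fun s => (hpos s).ne').pow 3)
  have hr : ∀ s, 0 < √(w s) := fun s => Real.sqrt_pos.2 (hpos s)
  have hr2 : ∀ s, √(w s) ^ 2 = w s := fun s => Real.sq_sqrt (hpos s).le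
  have hκ₁ : ∀ s, HasDerivAt (fun s => 1 / w s) (-w₁ s / w s ^ 2) s := fun s => by
    simpa using (hw₁ s).fun_inv (hpos s).ne'
  refine ⟨⟨⟨hfs.contDiffOn, fun s _ => ?_, hc.isUnitSpeedCurve hM hI hκs.contDiffOn, ?_⟩, ?_⟩,
    fun s hs => ⟨?_, ?_⟩⟩
  · rw [hf]
    exact mul_pos hc₁ (Real.rpow_pos_of_pos (hpos s) _)
  · intro p hp q hq hpq δ hδ F hF
    have hdr : ∀ s, HasDerivAt (fun s => √(w s)) (w₁ s / (2 * √(w s))) s := fun s =>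
      (hw₁ s).sqrt (hpos s).ne'
    have key := hc.hasDerivAt_fBienergy hM hI hκs.contDiffOn hfs.contDiffOn
      (g := fun s => c₁ * √(w s)) (g₁ := fun s => c₁ * (w₁ s / (2 * √(w s))))
      (g₂ := fun s => c₁ * ((w₂ s * (2 * √(w s)) - w₁ s * (2 * (w₁ s / (2 * √(w s)))))
        / (2 * √(w s)) ^ 2))
      (κ₁ := fun s => -w₁ s / w s ^ 2)
      (fun s _ => by
        rw [hf, hf3, ← hr2 s, Real.sqrt_sq (hr s).le]
        have := (hr s).ne'
        field_simp)
      (fun s _ => (hdr s).const_mul c₁)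
      (fun s _ => ((hw₂ s).fun_div ((hdr s).const_mul 2) (by have := hr s; positivity)).const_mul c₁)
      (fun s _ => hκ₁ s) ?_ ?_ hp hq hpq.le (hconn.out hp hq) hδ hF
    · refine key.congr_deriv ?_
      rw [← intervalIntegral.integral_zero (a := p) (b := q) (μ := volume)]
      refine intervalIntegral.integral_congr fun s _ => ?_
      have h0 := hode s
      have h1 := hr2 s
      have h2 := (hr s).ne'
      set r := √(w s)
      rw [← h1] at h0 ⊢
      -- The normal Euler–Lagrange equation; multiplied by `4r³`, with `r² = w`, it is the assumed
      -- equation for `w`.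
      have e1 : c₁ * ((w₂ s * (2 * r) - w₁ s * (2 * (w₁ s / (2 * r)))) / (2 * r) ^ 2)
          - c₁ * r * (1 / r ^ 2) ^ 2 + ε * (c₁ * r) = 0 := by
        field_simp
        linear_combination c₁ * h0
      -- The tangential equation holds identically, since `g²κ = c₁²`.
      have e2 : 2 * (c₁ * (w₁ s / (2 * r))) * (1 / r ^ 2) + c₁ * r * (-w₁ s / (r ^ 2) ^ 2) = 0 := by
        field_simp
        ring
      rw [e1, e2]
      ring
    · have hwc := hw.continuous
      have hw₁c := hw₁s.continuous
      refine Continuous.continuousOn (continuous_const.mul (Continuous.div ?_ ?_ ?_))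
      · refine (hw₂c.mul (continuous_const.mul hwc.sqrt)).sub (hw₁c.mul (continuous_const.mul
          (hw₁c.div (continuous_const.mul hwc.sqrt) ?_)))
        exact fun s => (mul_pos two_pos (hr s)).ne'
      · fun_prop
      · exact fun s => (pow_pos (mul_pos two_pos (hr s)) 2).ne'
    · exact (hw₁s.continuous.neg.div (hw.continuous.pow 2)
        fun s => (pow_pos (hpos s) 2).ne').continuousOn
  · obtain ⟨s₀, hs₀, hw0⟩ := hne
    -- The sign factor is `h = -w'`: as `κκ' = -w'/w³`, the product is `w'²/w³ ≥ 0`.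
    have e : ∀ s, -w₁ s * (1 / w s * (-w₁ s / w s ^ 2)) = w₁ s ^ 2 / w s ^ 3 := fun s => by
      have := (hpos s).ne'
      field_simp
    refine hc.not_isBiharmonicCurve hM hI hconn hκs.contDiffOn (fun s _ => hκ₁ s) hw₁s.neg
      (fun s _ => ?_) hs₀ ?_
    · have := hpos s
      rw [e]
      positivity
    · have := hpos s₀
      rw [e]
      positivity
  · rw [hc.geodesicCurvature_eq hM hI hs, abs_of_pos (one_div_pos.2 (hpos s))]
  · simp only
    rw [hf, one_div, Real.inv_rpow (hpos s).le, ← Real.rpow_neg (hpos s).le]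
    norm_num

end FBiharmonic

/-! ### Totally geodesic embeddings are affine. -/

section TotallyGeodesic

variable {E E' : Type*} [NormedAddCommGroup E] [NormedSpace ℝ E]
  [NormedAddCommGroup E'] [NormedSpace ℝ E']
  {M : EmbeddedSpace E} {M' : EmbeddedSpace E'} {B : E →L[ℝ] E →L[ℝ] ℝ} {B' : E' →L[ℝ] E' →L[ℝ] ℝ}
  {ε : ℝ} {C S : ℝ → ℝ} {I : Set ℝ} {c T N : ℝ → E} {κ : ℝ → ℝ} {ψ : E → E'}

namespace IsSpaceForm

theorem hasDerivAt_geodesic (hM : IsSpaceForm M B ε C S) (x v : E) (t : ℝ) :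
    HasDerivAt (fun t => C t • x + S t • v) ((-ε * S t) • x + C t • v) t :=
  ((hM.hasDerivAt_cos t).smul_const x).add ((hM.hasDerivAt_sin t).smul_const v)

theorem hasDerivAt_geodesic_velocity (hM : IsSpaceForm M B ε C S) (x v : E) (t : ℝ) :
    HasDerivAt (fun t => (-ε * S t) • x + C t • v) (-ε • (C t • x + S t • v)) t := by
  refine ((((hM.hasDerivAt_sin t).const_mul (-ε)).smul_const x).add
    ((hM.hasDerivAt_cos t).smul_const v)).congr_deriv ?_
  module

theorem speed_geodesic (hM : IsSpaceForm M B ε C S) {x v : E} (hx : x ∈ M.carrier)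
    (hv : ε * B x v = 0) (hv1 : B v v = 1) (t : ℝ) :
    ε * B ((-ε * S t) • x + C t • v) ((-ε * S t) • x + C t • v) = ε := by
  simp only [map_add, map_smul, smul_eq_mul, smul_apply, add_apply, hv1]
  rw [hM.symm v x]
  linear_combination (ε ^ 2 * S t ^ 2) * hM.self x hx - 2 * ε * S t * C t * hv
    + ε * hM.cos_sq_add t + ε * S t ^ 2 * hM.cube

theorem isGeodesic (hM : IsSpaceForm M B ε C S) {x v : E} (hx : x ∈ M.carrier)
    (hv : ε * B x v = 0) (hv1 : B v v = 1) : IsGeodesic M fun t => C t • x + S t • v where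
  smooth := (hM.smooth_cos.smul contDiff_const).add (hM.smooth_sin.smul contDiff_const)
  mem := hM.exp_mem x hx v hv hv1
  tension_eq_zero t := by
    rw [(hM.tension_eq isOpen_univ (fun t _ => hM.exp_mem x hx v hv hv1 t)
      (fun t _ => hM.hasDerivAt_geodesic x v t)
      (fun t _ => hM.hasDerivAt_geodesic_velocity x v t) (mem_univ t)).2,
      hM.speed_geodesic hx hv hv1]
    module

/-- Uniqueness for `h'' = -εh`: applying the inverse of the generalized rotation to `(h, h')` gives
two conserved quantities, and `C² + εS² = 1` recovers `h`. -/
theorem eq_of_hasDerivAt (hM : IsSpaceForm M B ε C S) {h h₁ : ℝ → E'}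
    (hh : ∀ t, HasDerivAt h (h₁ t) t) (hh₁ : ∀ t, HasDerivAt h₁ (-ε • h t) t) (t : ℝ) :
    h t = C t • h 0 + S t • h₁ 0 := by
  have d1 : ∀ t, HasDerivAt (fun t => C t • h t - S t • h₁ t) 0 t := fun t =>
    (((hM.hasDerivAt_cos t).fun_smul (hh t)).fun_sub
      ((hM.hasDerivAt_sin t).fun_smul (hh₁ t))).congr_deriv (by module)
  have d2 : ∀ t, HasDerivAt (fun t => (ε * S t) • h t + C t • h₁ t) 0 t := fun t =>
    ((((hM.hasDerivAt_sin t).const_mul ε).fun_smul (hh t)).fun_add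
      ((hM.hasDerivAt_cos t).fun_smul (hh₁ t))).congr_deriv (by module)
  have e1 := is_const_of_deriv_eq_zero (fun t => (d1 t).differentiableAt) (fun t => (d1 t).deriv) t 0
  have e2 := is_const_of_deriv_eq_zero (fun t => (d2 t).differentiableAt) (fun t => (d2 t).deriv) t 0
  simp only [hM.cos_zero, hM.sin_zero, one_smul, zero_smul, sub_zero, mul_zero, zero_add] at e1 e2
  rw [← e1, ← e2]
  calc h t = (C t ^ 2 + ε * S t ^ 2) • h t := by rw [hM.cos_sq_add, one_smul]
    _ = _ := by module

/-- A totally geodesic embedding of a space form whose points are all reached by geodesics from `x₀`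
is the restriction of an affine isometry, which is linear if the curvature is nonzero. -/
theorem exists_affine (hM : IsSpaceForm M B ε C S) (hM' : IsSpaceForm M' B' ε C S)
    (hψ : IsTotallyGeodesicEmbedding M M' ψ) {x₀ : E} (hx₀ : x₀ ∈ M.carrier)
    (hpolar : ∀ y ∈ M.carrier, ∃ v t, ε * B x₀ v = 0 ∧ B v v = 1 ∧ y = C t • x₀ + S t • v) :
    ∃ (A : E →L[ℝ] E') (b : E'), (∀ y ∈ M.carrier, ψ y = A y + b) ∧ ε • b = 0 ∧
      ∀ y z, B' (A y) (A z) = B y z := by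
  obtain ⟨L, hL⟩ := (hψ.smooth x₀ hx₀).differentiableWithinAt (by simp)
  have hcomp : ∀ {c : ℝ → E} {v : E}, (∀ t, c t ∈ M.carrier) → c 0 = x₀ → HasDerivAt c v 0 →
      HasDerivAt (ψ ∘ c) (L v) 0 := fun hmem h0 hd =>
    hL.comp_hasDerivAt_of_eq 0 hd (Eventually.of_forall hmem) h0.symm
  have htan : ∀ v, ε * B x₀ v = 0 → ε * B' (ψ x₀) (L v) = 0 ∧ B' (L v) (L v) = B v v := by
    intro v hv
    obtain ⟨c, hc, hmem, h0, hd⟩ := hM.exists_curve hx₀ hv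
    have h1 := hcomp hmem h0 hd
    refine ⟨?_, ?_⟩
    · have := hM'.tangent_of_hasDerivAt h1 (Eventually.of_forall fun t => hψ.mapsTo (hmem t))
      rwa [Function.comp_apply, h0] at this
    · have := hψ.isometric c hc hmem 0
      rwa [h1.deriv, hd.deriv, hM.form_eq, hM'.form_eq] at this
  -- The image curve has zero tension and the same speed, so it solves `h'' = -εh` with initial data
  -- `ψ x₀`, `L v`.
  have hexp : ∀ v, ε * B x₀ v = 0 → B v v = 1 → ∀ t,
      ψ (C t • x₀ + S t • v) = C t • ψ x₀ + S t • L v := by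
    intro v hv hv1 t
    have hgeo := hM.isGeodesic hx₀ hv hv1
    have hg := hψ.geodesic _ hgeo
    have hd0 := hcomp hgeo.mem (by simp [hM.cos_zero, hM.sin_zero]) (hM.hasDerivAt_geodesic x₀ v 0)
    have hd : ∀ t, HasDerivAt (ψ ∘ fun t => C t • x₀ + S t • v)
        (deriv (ψ ∘ fun t => C t • x₀ + S t • v) t) t := fun t =>
      (hg.smooth.differentiable (by simp) t).hasDerivAt
    have hsm := (contDiff_infty_iff_deriv.1 hg.smooth).2
    have hd₁ : ∀ t, HasDerivAt (deriv (ψ ∘ fun t => C t • x₀ + S t • v))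
        (deriv (deriv (ψ ∘ fun t => C t • x₀ + S t • v)) t) t := fun t =>
      (hsm.differentiable (by simp) t).hasDerivAt
    have h := hM.eq_of_hasDerivAt hd (fun t => (hd₁ t).congr_deriv ?_) t
    · simpa [hM.cos_zero, hM.sin_zero, hd0.deriv] using h
    · have h1 := (hM'.tension_eq isOpen_univ (fun t _ => hg.mem t) (fun t _ => hd t)
        (fun t _ => hd₁ t) (mem_univ t)).2
      have h2 := hψ.isometric _ hgeo.smooth hgeo.mem t
      rw [hM.form_eq, hM'.form_eq, (hM.hasDerivAt_geodesic x₀ v t).deriv] at h2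
      rw [hg.tension_eq_zero, h2, hM.speed_geodesic hx₀ hv hv1] at h1
      rw [neg_smul]
      exact eq_neg_of_add_eq_zero_left h1.symm
  -- Only the values of `L` on tangent vectors are meaningful. For `ε = ±1` the correction makes the
  -- linear map send `x₀` to `ψ x₀`, removing the arbitrary `L x₀`, and the translation vanishes;
  -- for `ε = 0` the linear part is `L` and the translation is `ψ x₀ - L x₀`.
  refine ⟨(ε • B x₀).smulRight (ψ x₀ - L x₀) + L, (1 - ε ^ 2) • (ψ x₀ - L x₀), fun y hy => ?_, ?_,
    ?_⟩
  · obtain ⟨v, t, hv, hv1, rfl⟩ := hpolar y hy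
    rw [hexp v hv hv1 t]
    have e : ε * B x₀ (C t • x₀ + S t • v) = ε ^ 2 * C t := by
      simp only [map_add, map_smul, smul_eq_mul]
      linear_combination C t * hM.self x₀ hx₀ + S t * hv
    simp only [add_apply, ContinuousLinearMap.smulRight_apply, smul_apply, smul_eq_mul, e]
    have e' : ε ^ 2 * C t + (1 - ε ^ 2) = C t := by linear_combination -hM.cos_of_flat t
    rw [add_right_comm, ← add_smul, e', map_add, map_smul, map_smul]
    module
  · rw [smul_smul, show ε * (1 - ε ^ 2) = 0 by linear_combination -hM.cube, zero_smul]
  · have hq : ∀ y, B' ((ε * B x₀ y) • (ψ x₀ - L x₀) + L y) ((ε * B x₀ y) • (ψ x₀ - L x₀) + L y)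
        = B y y := by
      intro y
      set a := ε * B x₀ y with ha
      have hv : ε * B x₀ (y - a • x₀) = 0 := by
        simp only [map_sub, map_smul, smul_eq_mul]
        linear_combination (-a) * hM.self x₀ hx₀ - B x₀ y * hM.cube + (1 - ε ^ 2) * ha
      obtain ⟨h1, h2⟩ := htan _ hv
      have e : a • (ψ x₀ - L x₀) + L y = a • ψ x₀ + L (y - a • x₀) := by
        rw [map_sub, map_smul]
        module
      have e' : y = a • x₀ + (y - a • x₀) := by abel
      have s1 := hM'.self _ (hψ.mapsTo hx₀)
      have s2 := hM.self _ hx₀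
      rw [e]
      conv_rhs => rw [e']
      generalize y - a • x₀ = v at *
      simp only [map_add, map_smul, smul_eq_mul, smul_apply, add_apply, h2]
      rw [hM.symm v x₀, hM'.symm (L v) (ψ x₀)]
      linear_combination (a * B x₀ y) * (s1 - s2) + 2 * B x₀ y * (h1 - hv)
        + (a * (B' (ψ x₀) (ψ x₀) - B x₀ x₀) + 2 * (B' (ψ x₀) (L v) - B x₀ v)) * ha
    intro y z
    have h1 := hq (y + z)
    have h2 := hq y
    have h3 := hq z
    simp only [add_apply, ContinuousLinearMap.smulRight_apply, smul_apply, smul_eq_mul]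
    have e : (ε * B x₀ (y + z)) • (ψ x₀ - L x₀) + L (y + z) =
        ((ε * B x₀ y) • (ψ x₀ - L x₀) + L y) + ((ε * B x₀ z) • (ψ x₀ - L x₀) + L z) := by
      rw [map_add, map_add]
      module
    rw [e] at h1
    generalize (ε * B x₀ y) • (ψ x₀ - L x₀) + L y = Y at *
    generalize (ε * B x₀ z) • (ψ x₀ - L x₀) + L z = Z at *
    simp only [map_add, add_apply] at h1
    rw [hM.symm z y, hM'.symm Z Y] at h1
    linarith

end IsSpaceForm

/-- The linear part of the affine map transports the frame. The condition `ε • b = 0` is what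
preserves the term `-εc` in the equation for `T'`. -/
theorem IsFrenetCurve.exists_comp (hc : IsFrenetCurve M B ε I c T N κ) (hI : IsOpen I)
    (hM : IsSpaceForm M B ε C S) (hM' : IsSpaceForm M' B' ε C S)
    (hψ : IsTotallyGeodesicEmbedding M M' ψ) {x₀ : E} (hx₀ : x₀ ∈ M.carrier)
    (hpolar : ∀ y ∈ M.carrier, ∃ v t, ε * B x₀ v = 0 ∧ B v v = 1 ∧ y = C t • x₀ + S t • v) :
    ∃ T' N' : ℝ → E', IsFrenetCurve M' B' ε I (ψ ∘ c) T' N' κ := by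
  obtain ⟨A, b, hA, hb, hiso⟩ := hM.exists_affine hM' hψ hx₀ hpolar
  have hcomp : ∀ {u : ℝ → E} {u' : E} {s : ℝ}, HasDerivAt u u' s →
      HasDerivAt (fun s => A (u s)) (A u') s := fun h => A.hasFDerivAt.comp_hasDerivAt _ h
  refine ⟨fun s => A (T s), fun s => A (N s), fun s hs => hψ.mapsTo (hc.mem s hs), fun s hs => ?_,
    fun s hs => ?_, fun s hs => ?_, fun s hs => ?_, fun s hs => ?_, fun s hs => ?_⟩
  · exact ((hcomp (hc.hasDerivAt s hs)).add_const b).congr_of_eventuallyEq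
      (eventually_of_mem (hI.mem_nhds hs) fun t ht => hA _ (hc.mem t ht))
  · refine (hcomp (hc.hasDerivAt_tangent s hs)).congr_deriv ?_
    rw [Function.comp_apply, hA _ (hc.mem s hs), smul_add, hb]
    simp
  · exact (hcomp (hc.hasDerivAt_normal s hs)).congr_deriv (by simp)
  · rw [hiso, hc.tangent_tangent s hs]
  · rw [hiso, hc.normal_normal s hs]
  · rw [hiso, hc.tangent_normal s hs]

end TotallyGeodesic

/-! ### The sphere, flat space and the hyperboloid as model spaces. -/

section Models

/-- The real inner product as a continuous bilinear map. -/
def innerBilin (E : Type*) [NormedAddCommGroup E] [InnerProductSpace ℝ E] : E →L[ℝ] E →L[ℝ] ℝ :=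
  innerSL ℝ

theorem innerBilin_apply {E : Type*} [NormedAddCommGroup E] [InnerProductSpace ℝ E] (x y : E) :
    innerBilin E x y = inner ℝ x y := rfl

theorem isSpaceForm_roundSphere (n : ℕ) :
    IsSpaceForm (roundSphere n) (innerBilin _) 1 Real.cos Real.sin where
  form_eq _ _ := rfl
  symm x y := real_inner_comm y x
  cube := by norm_num
  self x hx := by
    have hx : ‖x‖ = 1 := by simpa [roundSphere] using hx
    simp [innerBilin_apply, hx]
  pos x hx v _ hv := by
    rw [innerBilin_apply, real_inner_self_eq_norm_sq]
    have := norm_pos_iff.2 hv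
    positivity
  exp_mem x hx v hv hv1 t := by
    have hx : ‖x‖ = 1 := by simpa [roundSphere] using hx
    rw [innerBilin_apply, one_mul] at hv
    rw [innerBilin_apply, real_inner_self_eq_norm_sq] at hv1
    have h : ‖Real.cos t • x + Real.sin t • v‖ ^ 2 = 1 := by
      rw [norm_add_sq_real, norm_smul, norm_smul, inner_smul_left, inner_smul_right, hv, hx,
        mul_pow, mul_pow, hv1]
      simp
    simp only [roundSphere, mem_sphere_zero_iff_norm]
    nlinarith [norm_nonneg (Real.cos t • x + Real.sin t • v)]
  smooth_cos := Real.contDiff_cos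
  smooth_sin := Real.contDiff_sin
  hasDerivAt_cos t := (Real.hasDerivAt_cos t).congr_deriv (by ring)
  hasDerivAt_sin := Real.hasDerivAt_sin
  cos_zero := Real.cos_zero
  sin_zero := Real.sin_zero
  cos_sq_add t := by linear_combination Real.cos_sq_add_sin_sq t
  cos_of_flat t := by norm_num

theorem isSpaceForm_euclideanSpace (n : ℕ) :
    IsSpaceForm (euclideanSpace n) (innerBilin _) 0 (fun _ => 1) (fun t => t) where
  form_eq _ _ := rfl
  symm x y := real_inner_comm y x
  cube := by norm_num
  self x _ := by norm_num
  pos x _ v _ hv := by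
    rw [innerBilin_apply, real_inner_self_eq_norm_sq]
    have := norm_pos_iff.2 hv
    positivity
  exp_mem _ _ _ _ _ _ := mem_univ _
  smooth_cos := contDiff_const
  smooth_sin := contDiff_id
  hasDerivAt_cos t := (hasDerivAt_const t (1 : ℝ)).congr_deriv (by ring)
  hasDerivAt_sin := hasDerivAt_id
  cos_zero := rfl
  sin_zero := rfl
  cos_sq_add t := by norm_num
  cos_of_flat t := by norm_num

/-- The Lorentz form as a continuous bilinear map. -/
def lorentzBilin (n : ℕ) :
    EuclideanSpace ℝ (Fin (n + 1)) →L[ℝ] EuclideanSpace ℝ (Fin (n + 1)) →L[ℝ] ℝ :=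
  innerBilin _ - (2 : ℝ) • (EuclideanSpace.proj (𝕜 := ℝ) (0 : Fin (n + 1))).smulRight
    (EuclideanSpace.proj (𝕜 := ℝ) (0 : Fin (n + 1)))

theorem lorentzBilin_apply {n : ℕ} (x y : EuclideanSpace ℝ (Fin (n + 1))) :
    lorentzBilin n x y = lorentzForm x y := by
  simp [lorentzBilin, lorentzForm, innerBilin_apply, PiLp.inner_apply, Fin.sum_univ_succ]
  simp only [mul_comm (y _)]
  ring

/-- Cauchy–Schwarz for the spatial parts of `x` and `v`. It yields both positivity of the Lorentz
form on tangent spaces and the fact that geodesics stay on the upper sheet. -/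
theorem sq_sum_mul_le_of_lorentzForm {n : ℕ} {x v : EuclideanSpace ℝ (Fin (n + 1))}
    (hx : lorentzForm x x = -1) (hxv : lorentzForm x v = 0) :
    (x 0 * v 0) ^ 2 ≤ (x 0 ^ 2 - 1) * ∑ i : Fin n, v i.succ ^ 2 := by
  have h := Finset.sum_mul_sq_le_sq_mul_sq Finset.univ (fun i : Fin n => x i.succ)
    (fun i => v i.succ)
  simp only [lorentzForm, ← sq] at hx hxv
  rw [show ∑ i : Fin n, x i.succ ^ 2 = x 0 ^ 2 - 1 by linarith,
    show ∑ i : Fin n, x i.succ * v i.succ = x 0 * v 0 by linarith] at h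
  exact h

theorem isSpaceForm_hyperbolicSpace (n : ℕ) :
    IsSpaceForm (hyperbolicSpace n) (lorentzBilin n) (-1) Real.cosh Real.sinh where
  form_eq x y := by rw [lorentzBilin_apply]; rfl
  symm x y := by
    rw [lorentzBilin_apply, lorentzBilin_apply]
    simp [lorentzForm, mul_comm]
  cube := by norm_num
  self x hx := by
    rw [lorentzBilin_apply, hx.1]
    norm_num
  pos x hx v hv h0 := by
    rw [lorentzBilin_apply] at hv ⊢
    have h := sq_sum_mul_le_of_lorentzForm hx.1 (by linarith)
    have hx0 := hx.2
    have hs : 0 ≤ ∑ i : Fin n, v i.succ ^ 2 := Finset.sum_nonneg fun i _ => sq_nonneg _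
    simp only [lorentzForm, ← sq]
    rcases hs.eq_or_lt with hs0 | hs0
    · exfalso
      apply h0
      rw [← hs0, mul_zero] at h
      have hv0 : v 0 = 0 := by
        have : x 0 * v 0 = 0 := by nlinarith
        exact (mul_eq_zero.1 this).resolve_left hx0.ne'
      have hvi := (Finset.sum_eq_zero_iff_of_nonneg fun i _ => sq_nonneg (v (Fin.succ i))).1 hs0.symm
      ext i
      refine Fin.cases hv0 (fun j => ?_) i
      simpa using hvi j (Finset.mem_univ j)
    · set σ := ∑ i : Fin n, v i.succ ^ 2
      have : 0 < x 0 ^ 2 * (-v 0 ^ 2 + σ) := by nlinarith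
      exact pos_of_mul_pos_right this (sq_nonneg _)
  exp_mem x hx v hv hv1 t := by
    rw [lorentzBilin_apply] at hv hv1
    have hxv : lorentzForm x v = 0 := by linarith
    have h := sq_sum_mul_le_of_lorentzForm hx.1 hxv
    have hx0 := hx.2
    refine ⟨?_, ?_⟩
    · have h1 := hx.1
      rw [← lorentzBilin_apply] at h1 hxv hv1 ⊢
      have hvx : lorentzBilin n v x = 0 := by
        rw [lorentzBilin_apply] at hxv ⊢
        rw [← hxv]
        simp [lorentzForm, mul_comm]
      simp only [map_add, map_smul, smul_eq_mul, smul_apply, add_apply, h1, hxv, hvx, hv1]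
      linear_combination -Real.cosh_sq_sub_sinh_sq t
    · simp only [lorentzForm, ← sq] at hv1
      -- Together with `|sinh t| ≤ cosh t`, this keeps the time coordinate `cosh t · x₀ + sinh t ·
      -- v₀` positive.
      have h1 : |v 0| < x 0 := by
        rw [show ∑ i : Fin n, v i.succ ^ 2 = 1 + v 0 ^ 2 by linarith] at h
        exact abs_lt_of_sq_lt_sq (by nlinarith) hx0.le
      have h2 : |Real.sinh t| ≤ Real.cosh t :=
        abs_le_of_sq_le_sq (by nlinarith [Real.cosh_sq_sub_sinh_sq t]) (Real.cosh_pos t).le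
      have h3 : |Real.sinh t * v 0| ≤ Real.cosh t * |v 0| := by
        rw [abs_mul]
        exact mul_le_mul_of_nonneg_right h2 (abs_nonneg _)
      have h4 := Real.cosh_pos t
      simp only [PiLp.add_apply, PiLp.smul_apply, smul_eq_mul]
      nlinarith [neg_abs_le (Real.sinh t * v 0), mul_pos h4 (sub_pos.2 h1)]
  smooth_cos := Real.contDiff_cosh
  smooth_sin := Real.contDiff_sinh
  hasDerivAt_cos t := (Real.hasDerivAt_cosh t).congr_deriv (by ring)
  hasDerivAt_sin := Real.hasDerivAt_sinh
  cos_zero := Real.cosh_zero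
  sin_zero := Real.sinh_zero
  cos_sq_add t := by linear_combination Real.cosh_sq_sub_sinh_sq t
  cos_of_flat t := by norm_num

theorem exists_polar (a b : ℝ) : ∃ r θ : ℝ, a = r * Real.cos θ ∧ b = r * Real.sin θ ∧
    0 ≤ r ∧ r ^ 2 = a ^ 2 + b ^ 2 := by
  have h1 := Complex.norm_mul_cos_arg ⟨a, b⟩
  have h2 := Complex.norm_mul_sin_arg ⟨a, b⟩
  refine ⟨‖(⟨a, b⟩ : ℂ)‖, Complex.arg ⟨a, b⟩, h1.symm, h2.symm, norm_nonneg _, ?_⟩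
  rw [Complex.sq_norm, Complex.normSq_mk]
  ring

theorem roundSphere_two_polar (y : EuclideanSpace ℝ (Fin 3)) (hy : y ∈ (roundSphere 2).carrier) :
    ∃ v t, 1 * innerBilin _ (!₂[0, 0, 1] : EuclideanSpace ℝ (Fin 3)) v = 0 ∧ innerBilin _ v v = 1 ∧
      y = Real.cos t • !₂[0, 0, 1] + Real.sin t • v := by
  have hy1 : ‖y‖ ^ 2 = 1 := by
    rw [show ‖y‖ = 1 by simpa [roundSphere] using hy, one_pow]
  rw [EuclideanSpace.norm_sq_eq, Fin.sum_univ_three] at hy1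
  simp only [Real.norm_eq_abs, sq_abs] at hy1
  obtain ⟨r, θ, h0, h1, hr, hr2⟩ := exists_polar (y 0) (y 1)
  -- Polar coordinates twice: longitude `θ` from the first two coordinates, then the angle `t` from
  -- the pole.
  obtain ⟨r', t, h2, h3, hr', hr2'⟩ := exists_polar (y 2) r
  obtain rfl : r' = 1 := by nlinarith
  rw [one_mul] at h2 h3
  refine ⟨!₂[Real.cos θ, Real.sin θ, 0], t, ?_, ?_, ?_⟩
  · simp [innerBilin_apply, PiLp.inner_apply, Fin.sum_univ_three]
  · rw [innerBilin_apply]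
    simp only [PiLp.inner_apply, Fin.sum_univ_three]
    simp
  · ext i
    fin_cases i <;> simp [h0, h1, h2, h3]

theorem hyperbolicSpace_two_polar (y : EuclideanSpace ℝ (Fin 3))
    (hy : y ∈ (hyperbolicSpace 2).carrier) :
    ∃ v t, (-1) * lorentzBilin 2 (!₂[1, 0, 0] : EuclideanSpace ℝ (Fin 3)) v = 0 ∧
      lorentzBilin 2 v v = 1 ∧ y = Real.cosh t • !₂[1, 0, 0] + Real.sinh t • v := by
  obtain ⟨hy1, hy0⟩ := hy
  simp [lorentzForm, Fin.sum_univ_two] at hy1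
  obtain ⟨r, θ, h1, h2, hr, hr2⟩ := exists_polar (y 1) (y 2)
  -- The distance from the base point is the `arsinh` of the spatial radius.
  have hc : Real.cosh (Real.arsinh r) = y 0 := by
    rw [Real.cosh_arsinh, show 1 + r ^ 2 = y 0 ^ 2 by nlinarith, Real.sqrt_sq hy0.le]
  refine ⟨!₂[0, Real.cos θ, Real.sin θ], Real.arsinh r, ?_, ?_, ?_⟩
  · rw [lorentzBilin_apply]
    simp [lorentzForm, Fin.sum_univ_two]
  · rw [lorentzBilin_apply]
    simp [lorentzForm, Fin.sum_univ_two]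
    nlinarith [Real.sin_sq_add_cos_sq θ]
  · ext i
    fin_cases i <;> simp [h1, h2, hc]

theorem euclideanSpace_two_polar (y : EuclideanSpace ℝ (Fin 2)) :
    ∃ (v : EuclideanSpace ℝ (Fin 2)) (t : ℝ), 0 * innerBilin _ (0 : EuclideanSpace ℝ (Fin 2)) v = 0 ∧ innerBilin _ v v = 1 ∧
      y = (1 : ℝ) • (0 : EuclideanSpace ℝ (Fin 2)) + t • v := by
  obtain ⟨r, θ, h0, h1, -, -⟩ := exists_polar (y 0) (y 1)
  refine ⟨!₂[Real.cos θ, Real.sin θ], r, by simp, ?_, ?_⟩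
  · rw [innerBilin_apply]
    simp only [PiLp.inner_apply, Fin.sum_univ_two]
    simp
  · ext i
    fin_cases i <;> simp [h0, h1]

end Models

/-! ### Frenet frames of the explicit curves. -/

section FrenetModels

/-- Writing `r = sin θ` with `|θ| < π/2`, the root is `cos θ` and `m` is `θ'`. The bound `|r| < 1`
keeps the root differentiable. -/
theorem hasDerivAt_sqrt_one_sub_sq {r : ℝ → ℝ} {r₂ m s : ℝ} (hr : HasDerivAt r r₂ s)
    (h1 : |r s| < 1) (hr₂ : r₂ = √(1 - r s ^ 2) * m) :
    HasDerivAt (fun t => √(1 - r t ^ 2)) (-r s * m) s := by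
  have hpos : 0 < 1 - r s ^ 2 := by nlinarith [(sq_lt_one_iff_abs_lt_one (r s)).2 h1]
  have h := ((hr.fun_pow 2).const_sub 1).sqrt hpos.ne'
  refine h.congr_deriv ?_
  have := (Real.sqrt_pos.2 hpos).ne'
  rw [hr₂]
  field_simp
  push_cast
  ring

theorem sq_sqrt_one_sub_sq {r : ℝ} (h1 : |r| < 1) : √(1 - r ^ 2) ^ 2 + r ^ 2 = 1 := by
  rw [Real.sq_sqrt (by nlinarith [(sq_lt_one_iff_abs_lt_one r).2 h1])]
  ring

/-- With `q = √(1 - ρ'²)` and the orthonormal directions `∂_ρ` and `e = (-sin φ, cos φ, 0)`, the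
frame is `T = ρ' ∂_ρ + q e`, `N = ρ' e - q ∂_ρ`. No sign of `cos ρ` is needed, as the choice of `φ'`
makes the `e`-component of the velocity equal to `q`. -/
theorem isFrenetCurve_spherePoint {I : Set ℝ} {ρ ρ₁ ρ₂ φ κ : ℝ → ℝ}
    (hρ : ∀ s ∈ I, HasDerivAt ρ (ρ₁ s) s) (hρ₁ : ∀ s ∈ I, HasDerivAt ρ₁ (ρ₂ s) s)
    (hcos : ∀ s ∈ I, Real.cos (ρ s) ≠ 0) (hlt : ∀ s ∈ I, |ρ₁ s| < 1)
    (hode : ∀ s ∈ I, ρ₂ s + (1 - ρ₁ s ^ 2) * Real.tan (ρ s) + √(1 - ρ₁ s ^ 2) * κ s = 0)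
    (hφ : ∀ s ∈ I, HasDerivAt φ (√(1 - ρ₁ s ^ 2) / Real.cos (ρ s)) s) :
    ∃ T N, IsFrenetCurve (roundSphere 2) (innerBilin _) 1 I (fun s => spherePoint (ρ s) (φ s))
      T N κ := by
  set q : ℝ → ℝ := fun s => √(1 - ρ₁ s ^ 2) with hq
  have hq2 : ∀ s ∈ I, q s ^ 2 + ρ₁ s ^ 2 = 1 := fun s hs => sq_sqrt_one_sub_sq (hlt s hs)
  -- Factoring out `q` lets the same bracket serve as angular velocity in the derivatives of both
  -- `ρ'` and `q`.
  have hode' : ∀ s ∈ I, ρ₂ s = q s * -(q s * Real.tan (ρ s) + κ s) := fun s hs => by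
    linear_combination hode s hs + Real.tan (ρ s) * hq2 s hs
  have hq' : ∀ s ∈ I, HasDerivAt q (-ρ₁ s * -(q s * Real.tan (ρ s) + κ s)) s := fun s hs =>
    hasDerivAt_sqrt_one_sub_sq (hρ₁ s hs) (hlt s hs) (hode' s hs)
  have k0 : ∀ s ∈ I, Real.cos (ρ s) * (q s / Real.cos (ρ s)) = q s := fun s hs =>
    mul_div_cancel₀ _ (hcos s hs)
  have k3 : ∀ s ∈ I, Real.tan (ρ s) * Real.cos (ρ s) = Real.sin (ρ s) := fun s hs =>
    Real.tan_mul_cos (hcos s hs)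
  have k1 : ∀ s ∈ I, Real.sin (ρ s) * (q s / Real.cos (ρ s)) = q s * Real.tan (ρ s) :=
    fun s hs => by rw [← k3 s hs, mul_assoc, k0 s hs, mul_comm]
  have k2 : ∀ s ∈ I, Real.sin (ρ s) * Real.tan (ρ s) * q s - q s / Real.cos (ρ s)
      = -Real.cos (ρ s) * q s := fun s hs => by
    linear_combination -Real.sin (ρ s) * k1 s hs - Real.cos (ρ s) * k0 s hs
      + q s / Real.cos (ρ s) * Real.sin_sq_add_cos_sq (ρ s)
  refine ⟨fun s => !₂[-Real.sin (ρ s) * Real.cos (φ s) * ρ₁ s - q s * Real.sin (φ s),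
      -Real.sin (ρ s) * Real.sin (φ s) * ρ₁ s + q s * Real.cos (φ s), Real.cos (ρ s) * ρ₁ s],
    fun s => !₂[q s * Real.sin (ρ s) * Real.cos (φ s) - ρ₁ s * Real.sin (φ s),
      q s * Real.sin (ρ s) * Real.sin (φ s) + ρ₁ s * Real.cos (φ s), -q s * Real.cos (ρ s)],
    fun s _ => spherePoint_mem _ _, fun s hs => ?_, fun s hs => ?_, fun s hs => ?_, fun s hs => ?_,
    fun s hs => ?_, fun s hs => ?_⟩
  · have dρ := hρ s hs
    have dφ := hφ s hs
    have h0 := k0 s hs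
    refine hasDerivAt_of_coords fun i => ?_
    fin_cases i
    · refine (dρ.cos.fun_mul dφ.cos).congr_deriv ?_
      simp
      linear_combination -Real.sin (φ s) * h0
    · refine (dρ.cos.fun_mul dφ.sin).congr_deriv ?_
      simp
      linear_combination Real.cos (φ s) * h0
    · exact dρ.sin
  · have dρ := hρ s hs
    have dφ := hφ s hs
    have dρ₁ := hρ₁ s hs
    have dq := hq' s hs
    have e := hode' s hs
    have e2 := hq2 s hs
    have h1 := k1 s hs
    have h2 := k2 s hs
    have h3 := k3 s hs
    refine hasDerivAt_of_coords fun i => ?_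
    fin_cases i
    · refine (((dρ.sin.fun_neg.fun_mul dφ.cos).fun_mul dρ₁).fun_sub
        (dq.fun_mul dφ.sin)).congr_deriv ?_
      simp [spherePoint]
      rw [e]
      linear_combination ρ₁ s * Real.sin (φ s) * h1 + q s * Real.cos (φ s) * h2
        - Real.cos (ρ s) * Real.cos (φ s) * e2
    · refine (((dρ.sin.fun_neg.fun_mul dφ.sin).fun_mul dρ₁).fun_add
        (dq.fun_mul dφ.cos)).congr_deriv ?_
      simp [spherePoint]
      rw [e]
      linear_combination -ρ₁ s * Real.cos (φ s) * h1 + q s * Real.sin (φ s) * h2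
        - Real.cos (ρ s) * Real.sin (φ s) * e2
    · refine (dρ.cos.fun_mul dρ₁).congr_deriv ?_
      simp [spherePoint]
      rw [e]
      linear_combination -q s ^ 2 * h3 - Real.sin (ρ s) * e2
  · have dρ := hρ s hs
    have dφ := hφ s hs
    have dρ₁ := hρ₁ s hs
    have dq := hq' s hs
    have e := hode' s hs
    have h1 := k1 s hs
    have h2 := k2 s hs
    have h3 := k3 s hs
    refine hasDerivAt_of_coords fun i => ?_
    fin_cases i
    · refine (((dq.fun_mul dρ.sin).fun_mul dφ.cos).fun_sub (dρ₁.fun_mul dφ.sin)).congr_deriv ?_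
      simp
      rw [e]
      linear_combination ρ₁ s * Real.cos (φ s) * h2 - q s * Real.sin (φ s) * h1
    · refine (((dq.fun_mul dρ.sin).fun_mul dφ.sin).fun_add (dρ₁.fun_mul dφ.cos)).congr_deriv ?_
      simp
      rw [e]
      linear_combination ρ₁ s * Real.sin (φ s) * h2 + q s * Real.cos (φ s) * h1
    · refine (dq.fun_neg.fun_mul dρ.cos).congr_deriv ?_
      simp
      linear_combination -ρ₁ s * q s * h3
  all_goals
    have e2 := hq2 s hs
    rw [innerBilin_apply]
    simp only [PiLp.inner_apply, Fin.sum_univ_three]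
    simp [mul_pow, sq_abs]
  · linear_combination (Real.sin (ρ s) ^ 2 * ρ₁ s ^ 2 + q s ^ 2) * Real.sin_sq_add_cos_sq (φ s)
      + ρ₁ s ^ 2 * Real.sin_sq_add_cos_sq (ρ s) + e2
  · linear_combination (Real.sin (ρ s) ^ 2 * q s ^ 2 + ρ₁ s ^ 2) * Real.sin_sq_add_cos_sq (φ s)
      + q s ^ 2 * Real.sin_sq_add_cos_sq (ρ s) + e2
  · linear_combination (-Real.sin (ρ s) ^ 2 * q s * ρ₁ s + q s * ρ₁ s) *
      Real.sin_sq_add_cos_sq (φ s) - q s * ρ₁ s * Real.sin_sq_add_cos_sq (ρ s)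

/-- The same construction with `∂_u` and the unit vector `e = e^{-u} ∂_v = (v, 1, -v)`: `T = u' ∂_u
+ q e`, `N = u' e - q ∂_u`. -/
theorem isFrenetCurve_hyperbolicPoint {I : Set ℝ} {u u₁ u₂ v κ : ℝ → ℝ}
    (hu : ∀ s ∈ I, HasDerivAt u (u₁ s) s) (hu₁ : ∀ s ∈ I, HasDerivAt u₁ (u₂ s) s)
    (hlt : ∀ s ∈ I, |u₁ s| < 1)
    (hode : ∀ s ∈ I, u₂ s - (1 - u₁ s ^ 2) + √(1 - u₁ s ^ 2) * κ s = 0)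
    (hv : ∀ s ∈ I, HasDerivAt v (√(1 - u₁ s ^ 2) / Real.exp (u s)) s) :
    ∃ T N, IsFrenetCurve (hyperbolicSpace 2) (lorentzBilin 2) (-1) I
      (fun s => hyperbolicPoint (u s) (v s)) T N κ := by
  set q : ℝ → ℝ := fun s => √(1 - u₁ s ^ 2) with hq
  have hq2 : ∀ s ∈ I, q s ^ 2 + u₁ s ^ 2 = 1 := fun s hs => sq_sqrt_one_sub_sq (hlt s hs)
  have hode' : ∀ s ∈ I, u₂ s = q s * (q s - κ s) := fun s hs => by
    linear_combination hode s hs - hq2 s hs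
  have hq' : ∀ s ∈ I, HasDerivAt q (-u₁ s * (q s - κ s)) s := fun s hs =>
    hasDerivAt_sqrt_one_sub_sq (hu₁ s hs) (hlt s hs) (hode' s hs)
  have k0 : ∀ s, Real.exp (u s) * (q s / Real.exp (u s)) = q s := fun s =>
    mul_div_cancel₀ _ (Real.exp_pos _).ne'
  have k1 : ∀ s, (Real.cosh (u s) - Real.sinh (u s)) * q s = q s / Real.exp (u s) := fun s => by
    rw [Real.cosh_sub_sinh, Real.exp_neg, div_eq_inv_mul]
  have dv2 : ∀ s ∈ I, HasDerivAt (fun t => v t ^ 2) (2 * v s * (q s / Real.exp (u s))) s :=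
    fun s hs => ((hv s hs).fun_pow 2).congr_deriv (by simp [hq])
  refine ⟨fun s => !₂[(Real.sinh (u s) + Real.exp (u s) * v s ^ 2 / 2) * u₁ s + q s * v s,
      Real.exp (u s) * v s * u₁ s + q s,
      (Real.cosh (u s) - Real.exp (u s) * v s ^ 2 / 2) * u₁ s - q s * v s],
    fun s => !₂[u₁ s * v s - q s * (Real.sinh (u s) + Real.exp (u s) * v s ^ 2 / 2),
      u₁ s - q s * (Real.exp (u s) * v s),
      -q s * (Real.cosh (u s) - Real.exp (u s) * v s ^ 2 / 2) - u₁ s * v s],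
    fun s _ => hyperbolicPoint_mem _ _, fun s hs => ?_, fun s hs => ?_, fun s hs => ?_,
    fun s hs => ?_, fun s hs => ?_, fun s hs => ?_⟩
  · have du := hu s hs
    have dv := hv s hs
    have dw := (du.exp.fun_mul (dv2 s hs)).div_const 2
    have h0 := k0 s
    refine hasDerivAt_of_coords fun i => ?_
    fin_cases i
    · refine (du.cosh.fun_add dw).congr_deriv ?_
      simp
      linear_combination v s * h0
    · refine (du.exp.fun_mul dv).congr_deriv ?_
      simp
      linear_combination h0
    · refine (du.sinh.fun_sub dw).congr_deriv ?_
      simp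
      linear_combination -v s * h0
  · have du := hu s hs
    have dv := hv s hs
    have du₁ := hu₁ s hs
    have dq := hq' s hs
    have dw := (du.exp.fun_mul (dv2 s hs)).div_const 2
    have e := hode' s hs
    have e2 := hq2 s hs
    have h0 := k0 s
    have h1 := k1 s
    refine hasDerivAt_of_coords fun i => ?_
    fin_cases i
    · refine (((du.sinh.fun_add dw).fun_mul du₁).fun_add (dq.fun_mul dv)).congr_deriv ?_
      simp [hyperbolicPoint]
      rw [e]
      linear_combination (Real.cosh (u s) + Real.exp (u s) * v s ^ 2 / 2) * e2 + u₁ s * v s * h0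
        - q s * h1
    · refine (((du.exp.fun_mul dv).fun_mul du₁).fun_add dq).congr_deriv ?_
      simp [hyperbolicPoint]
      rw [e]
      linear_combination Real.exp (u s) * v s * e2 + u₁ s * h0
    · refine (((du.cosh.fun_sub dw).fun_mul du₁).fun_sub (dq.fun_mul dv)).congr_deriv ?_
      simp [hyperbolicPoint]
      rw [e]
      linear_combination (Real.sinh (u s) - Real.exp (u s) * v s ^ 2 / 2) * e2 - u₁ s * v s * h0
        + q s * h1
  · have du := hu s hs
    have dv := hv s hs
    have du₁ := hu₁ s hs
    have dq := hq' s hs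
    have dw := (du.exp.fun_mul (dv2 s hs)).div_const 2
    have e := hode' s hs
    have h0 := k0 s
    have h1 := k1 s
    refine hasDerivAt_of_coords fun i => ?_
    fin_cases i
    · refine ((du₁.fun_mul dv).fun_sub (dq.fun_mul (du.sinh.fun_add dw))).congr_deriv ?_
      simp
      rw [e]
      linear_combination -u₁ s * h1 - q s * v s * h0
    · refine (du₁.fun_sub (dq.fun_mul (du.exp.fun_mul dv))).congr_deriv ?_
      simp
      rw [e]
      linear_combination -q s * h0
    · refine ((dq.fun_neg.fun_mul (du.cosh.fun_sub dw)).fun_sub (du₁.fun_mul dv)).congr_deriv ?_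
      simp
      rw [e]
      linear_combination u₁ s * h1 + q s * v s * h0
  all_goals
    have e2 := hq2 s hs
    -- `huu` says that `∂_u` is a unit vector, `huv` that it is orthogonal to `e`.
    have huu : -(Real.sinh (u s) + Real.exp (u s) * v s ^ 2 / 2) ^ 2 + (Real.exp (u s) * v s) ^ 2
        + (Real.cosh (u s) - Real.exp (u s) * v s ^ 2 / 2) ^ 2 = 1 := by
      linear_combination Real.cosh_sq_sub_sinh_sq (u s)
        - Real.exp (u s) * v s ^ 2 * Real.sinh_add_cosh (u s)
    have huv : -(Real.sinh (u s) + Real.exp (u s) * v s ^ 2 / 2) * v s + Real.exp (u s) * v s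
        - (Real.cosh (u s) - Real.exp (u s) * v s ^ 2 / 2) * v s = 0 := by
      linear_combination -v s * Real.sinh_add_cosh (u s)
    rw [lorentzBilin_apply]
    simp [lorentzForm, Fin.sum_univ_two]
  · linear_combination u₁ s ^ 2 * huu + 2 * u₁ s * q s * huv + e2
  · linear_combination q s ^ 2 * huu - 2 * u₁ s * q s * huv + e2
  · linear_combination -u₁ s * q s * huu + (u₁ s ^ 2 - q s ^ 2) * huv

theorem isFrenetCurve_planePoint {I : Set ℝ} {x x₁ x₂ y κ : ℝ → ℝ}
    (hx : ∀ s ∈ I, HasDerivAt x (x₁ s) s) (hx₁ : ∀ s ∈ I, HasDerivAt x₁ (x₂ s) s)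
    (hlt : ∀ s ∈ I, |x₁ s| < 1) (hode : ∀ s ∈ I, x₂ s + √(1 - x₁ s ^ 2) * κ s = 0)
    (hy : ∀ s ∈ I, HasDerivAt y (√(1 - x₁ s ^ 2)) s) :
    ∃ T N, IsFrenetCurve (euclideanSpace 2) (innerBilin _) 0 I (fun s => planePoint (x s) (y s))
      T N κ := by
  set q : ℝ → ℝ := fun s => √(1 - x₁ s ^ 2) with hq
  have hode' : ∀ s ∈ I, x₂ s = q s * -κ s := fun s hs => by
    linear_combination hode s hs
  have hq' : ∀ s ∈ I, HasDerivAt q (-x₁ s * -κ s) s := fun s hs =>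
    hasDerivAt_sqrt_one_sub_sq (hx₁ s hs) (hlt s hs) (hode' s hs)
  refine ⟨fun s => !₂[x₁ s, q s], fun s => !₂[-q s, x₁ s], fun s _ => mem_univ _, fun s hs => ?_,
    fun s hs => ?_, fun s hs => ?_, fun s hs => ?_, fun s hs => ?_, fun s hs => ?_⟩
  · refine hasDerivAt_of_coords fun i => ?_
    fin_cases i
    · exact hx s hs
    · exact hy s hs
  · refine hasDerivAt_of_coords fun i => ?_
    fin_cases i
    · refine (hx₁ s hs).congr_deriv ?_
      simp [hode' s hs, mul_comm]
    · refine (hq' s hs).congr_deriv ?_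
      simp [mul_comm]
  · refine hasDerivAt_of_coords fun i => ?_
    fin_cases i
    · refine (hq' s hs).fun_neg.congr_deriv ?_
      simp [mul_comm]
    · refine (hx₁ s hs).congr_deriv ?_
      simp [hode' s hs, mul_comm]
  all_goals
    have e2 : q s ^ 2 + x₁ s ^ 2 = 1 := sq_sqrt_one_sub_sq (hlt s hs)
    rw [innerBilin_apply]
    simp only [PiLp.inner_apply, Fin.sum_univ_two]
    simp
  · linear_combination e2
  · linear_combination e2
  · ring

end FrenetModels

/-- If `w'` vanished on the open set `I`, so would `w''`; hence `w` is nonconstant on `I`. -/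
theorem exists_mem_ne_zero {I : Set ℝ} (hI : IsOpen I) (hne : I.Nonempty) {w₁ w₂ : ℝ → ℝ}
    (hw : ∀ s, HasDerivAt w₁ (w₂ s) s) (h : ∀ s, w₁ s = 0 → w₂ s ≠ 0) : ∃ s ∈ I, w₁ s ≠ 0 := by
  by_contra! hz
  obtain ⟨s, hs⟩ := hne
  exact h s (hz s hs) ((hw s).unique ((hasDerivAt_const s (0 : ℝ)).congr_of_eventuallyEq
    (eventually_of_mem (hI.mem_nhds hs) hz)))

end

/-! ### The three families of explicit curves. -/

theorem mainTheorem9 (I : Set ℝ) (hI : IsOpen I) (hconn : I.OrdConnected) (hne : I.Nonempty)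
    (c₁ : ℝ) (hc₁ : 0 < c₁) :
    -- (1) curves in the sphere
    (∀ C₄ C₅ : ℝ, (C₄ ≠ 0 ∨ C₅ ≠ 0) →
      ∀ ρ ρ₁ ρ₂ φ : ℝ → ℝ,
      (∀ s ∈ I, HasDerivAt ρ (ρ₁ s) s) →
      (∀ s ∈ I, HasDerivAt ρ₁ (ρ₂ s) s) →
      (∀ s ∈ I, Real.cos (ρ s) ≠ 0) →
      (∀ s ∈ I, |ρ₁ s| < 1) →
      (∀ s ∈ I, ρ₂ s + (1 - ρ₁ s ^ 2) * Real.tan (ρ s)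
        + √(1 - ρ₁ s ^ 2) / (C₄ * Real.cos (2 * s) + C₅ * Real.sin (2 * s)
            + √(1 + C₄ ^ 2 + C₅ ^ 2)) = 0) →
      (∀ s ∈ I, HasDerivAt φ (√(1 - ρ₁ s ^ 2) / Real.cos (ρ s)) s) →
      ∀ (κ f : ℝ → ℝ) (γ : ℝ → EuclideanSpace ℝ (Fin 3)),
      (κ = fun s => 1 / (C₄ * Real.cos (2 * s) + C₅ * Real.sin (2 * s)
        + √(1 + C₄ ^ 2 + C₅ ^ 2))) →
      (f = fun s => c₁ * (C₄ * Real.cos (2 * s) + C₅ * Real.sin (2 * s)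
        + √(1 + C₄ ^ 2 + C₅ ^ 2)) ^ ((3 : ℝ) / 2)) →
      (γ = fun s => spherePoint (ρ s) (φ s)) →
      (IsProperFBiharmonicCurve (roundSphere 2) I f γ ∧
        ∀ s ∈ I, geodesicCurvature (roundSphere 2) γ s = κ s ∧
          f s = c₁ * κ s ^ (-(3 : ℝ) / 2)) ∧
      ∀ (n : ℕ) (ψ : EuclideanSpace ℝ (Fin 3) → EuclideanSpace ℝ (Fin (n + 1))),
        IsTotallyGeodesicEmbedding (roundSphere 2) (roundSphere n) ψ →
        IsProperFBiharmonicCurve (roundSphere n) I f (ψ ∘ γ) ∧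
        ∀ s ∈ I, geodesicCurvature (roundSphere n) (ψ ∘ γ) s = κ s) ∧
    -- (2) curves in the hyperbolic plane
    (∀ C₁ C₂ : ℝ, 0 < C₁ → 0 < C₂ → 0 < 4 * C₁ * C₂ - 1 →
      ∀ u u₁ u₂ v : ℝ → ℝ,
      (∀ s ∈ I, HasDerivAt u (u₁ s) s) →
      (∀ s ∈ I, HasDerivAt u₁ (u₂ s) s) →
      (∀ s ∈ I, |u₁ s| < 1) →
      (∀ s ∈ I, u₂ s - (1 - u₁ s ^ 2)
        + √(1 - u₁ s ^ 2) / (C₁ * Real.exp (2 * s) + C₂ * Real.exp (-2 * s)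
            + √(4 * C₁ * C₂ - 1)) = 0) →
      (∀ s ∈ I, HasDerivAt v (√(1 - u₁ s ^ 2) / Real.exp (u s)) s) →
      ∀ (κ f : ℝ → ℝ) (γ : ℝ → EuclideanSpace ℝ (Fin 3)),
      (κ = fun s => 1 / (C₁ * Real.exp (2 * s) + C₂ * Real.exp (-2 * s)
        + √(4 * C₁ * C₂ - 1))) →
      (f = fun s => c₁ * (C₁ * Real.exp (2 * s) + C₂ * Real.exp (-2 * s)
        + √(4 * C₁ * C₂ - 1)) ^ ((3 : ℝ) / 2)) →
      (γ = fun s => hyperbolicPoint (u s) (v s)) →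
      (IsProperFBiharmonicCurve (hyperbolicSpace 2) I f γ ∧
        ∀ s ∈ I, geodesicCurvature (hyperbolicSpace 2) γ s = κ s ∧
          f s = c₁ * κ s ^ (-(3 : ℝ) / 2)) ∧
      ∀ (n : ℕ) (ψ : EuclideanSpace ℝ (Fin 3) → EuclideanSpace ℝ (Fin (n + 1))),
        IsTotallyGeodesicEmbedding (hyperbolicSpace 2) (hyperbolicSpace n) ψ →
        IsProperFBiharmonicCurve (hyperbolicSpace n) I f (ψ ∘ γ) ∧
        ∀ s ∈ I, geodesicCurvature (hyperbolicSpace n) (ψ ∘ γ) s = κ s) ∧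
    -- (3) curves in the plane
    (∀ C₃ C₄ : ℝ, 0 < C₃ →
      ∀ x x₁ x₂ y : ℝ → ℝ,
      (∀ s ∈ I, HasDerivAt x (x₁ s) s) →
      (∀ s ∈ I, HasDerivAt x₁ (x₂ s) s) →
      (∀ s ∈ I, |x₁ s| < 1) →
      (∀ s ∈ I, x₂ s + 4 * C₃ * √(1 - x₁ s ^ 2) / (16 + C₃ ^ 2 * (s + C₄) ^ 2) = 0) →
      (∀ s ∈ I, HasDerivAt y (√(1 - x₁ s ^ 2)) s) →
      ∀ (κ f : ℝ → ℝ) (γ : ℝ → EuclideanSpace ℝ (Fin 2)),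
      (κ = fun s => 4 * C₃ / (16 + C₃ ^ 2 * (s + C₄) ^ 2)) →
      (f = fun s => c₁ * (4 * C₃ / (16 + C₃ ^ 2 * (s + C₄) ^ 2)) ^ (-(3 : ℝ) / 2)) →
      (γ = fun s => planePoint (x s) (y s)) →
      (IsProperFBiharmonicCurve (euclideanSpace 2) I f γ ∧
        ∀ s ∈ I, geodesicCurvature (euclideanSpace 2) γ s = κ s ∧
          f s = c₁ * κ s ^ (-(3 : ℝ) / 2)) ∧
      ∀ (n : ℕ) (ψ : EuclideanSpace ℝ (Fin 2) → EuclideanSpace ℝ (Fin n)),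
        IsTotallyGeodesicEmbedding (euclideanSpace 2) (euclideanSpace n) ψ →
        IsProperFBiharmonicCurve (euclideanSpace n) I f (ψ ∘ γ) ∧
        ∀ s ∈ I, geodesicCurvature (euclideanSpace n) (ψ ∘ γ) s = κ s) := by
  refine ⟨?_, ?_, ?_⟩
  · rintro C₄ C₅ hC ρ ρ₁ ρ₂ φ hρ hρ₁ hcos hlt hode hφ κ f γ rfl rfl rfl
    have hpos : 0 < 1 + C₄ ^ 2 + C₅ ^ 2 := by positivity
    set D := √(1 + C₄ ^ 2 + C₅ ^ 2) with hD
    have hD0 : 0 < D := Real.sqrt_pos.2 hpos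
    have hD2 : D ^ 2 = 1 + C₄ ^ 2 + C₅ ^ 2 := Real.sq_sqrt hpos.le
    obtain ⟨T, N, hc⟩ := isFrenetCurve_spherePoint
      (κ := fun s => 1 / (C₄ * Real.cos (2 * s) + C₅ * Real.sin (2 * s) + D)) hρ hρ₁ hcos hlt
      (fun s hs => by rw [← hode s hs]; ring) hφ
    have d2 : ∀ s : ℝ, HasDerivAt (fun s : ℝ => 2 * s) 2 s := fun s => by
      simpa using (hasDerivAt_id s).const_mul 2
    have hw₁ : ∀ s, HasDerivAt (fun s => C₄ * Real.cos (2 * s) + C₅ * Real.sin (2 * s) + D)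
        (2 * (C₅ * Real.cos (2 * s) - C₄ * Real.sin (2 * s))) s := fun s =>
      ((((d2 s).cos.const_mul C₄).fun_add ((d2 s).sin.const_mul C₅)).add_const D).congr_deriv
        (by ring)
    have hw₂ : ∀ s, HasDerivAt (fun s => 2 * (C₅ * Real.cos (2 * s) - C₄ * Real.sin (2 * s)))
        (-4 * (C₄ * Real.cos (2 * s) + C₅ * Real.sin (2 * s))) s := fun s =>
      ((((d2 s).cos.const_mul C₅).fun_sub ((d2 s).sin.const_mul C₄)).const_mul 2).congr_deriv
        (by ring)
    -- With `A` the oscillating part of `w`, this is `A² + (w'/2)² = C₄² + C₅²`. It shows that `w''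
    -- = -4A ≠ 0` where `w' = 0`, that `|A| < D`, and, with `D² = 1 + C₄² + C₅²`, the equation for
    -- `w`.
    have hamp : ∀ s, (C₄ * Real.cos (2 * s) + C₅ * Real.sin (2 * s)) ^ 2
        + (C₅ * Real.cos (2 * s) - C₄ * Real.sin (2 * s)) ^ 2 = C₄ ^ 2 + C₅ ^ 2 := fun s => by
      linear_combination (C₄ ^ 2 + C₅ ^ 2) * Real.sin_sq_add_cos_sq (2 * s)
    have hC2 : 0 < C₄ ^ 2 + C₅ ^ 2 := by
      rcases hC with h | h <;> positivity
    have hcrit := exists_mem_ne_zero hI hne hw₂ fun s h1 h2 => by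
      have := hamp s
      nlinarith
    have hsm : ContDiff ℝ ∞ fun s => C₄ * Real.cos (2 * s) + C₅ * Real.sin (2 * s) + D := by
      fun_prop
    have hwpos : ∀ s, 0 < C₄ * Real.cos (2 * s) + C₅ * Real.sin (2 * s) + D := fun s => by
      have := abs_lt_of_sq_lt_sq (show (C₄ * Real.cos (2 * s) + C₅ * Real.sin (2 * s)) ^ 2 < D ^ 2 by
        nlinarith [hamp s]) hD0.le
      linarith [(abs_lt.1 this).1]
    have hw_ode : ∀ s, 2 * (C₄ * Real.cos (2 * s) + C₅ * Real.sin (2 * s) + D) *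
        (-4 * (C₄ * Real.cos (2 * s) + C₅ * Real.sin (2 * s)))
        - (2 * (C₅ * Real.cos (2 * s) - C₄ * Real.sin (2 * s))) ^ 2
        = 4 - 4 * 1 * (C₄ * Real.cos (2 * s) + C₅ * Real.sin (2 * s) + D) ^ 2 := fun s => by
      linear_combination -4 * hamp s + 4 * hD2
    refine ⟨hc.isProperFBiharmonicCurve (isSpaceForm_roundSphere 2) hI hconn hc₁ hsm hw₁ hw₂ hwpos
      hw_ode (fun _ => rfl) (fun _ => rfl) hcrit, fun n ψ hψ => ?_⟩
    obtain ⟨T', N', hc'⟩ := hc.exists_comp hI (isSpaceForm_roundSphere 2)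
      (isSpaceForm_roundSphere n) hψ (by simp [roundSphere, EuclideanSpace.norm_eq,
        Fin.sum_univ_three]) roundSphere_two_polar
    have key := hc'.isProperFBiharmonicCurve (isSpaceForm_roundSphere n) hI hconn hc₁ hsm hw₁ hw₂
      hwpos hw_ode (fun _ => rfl) (fun _ => rfl) hcrit
    exact ⟨key.1, fun s hs => (key.2 s hs).1⟩
  · rintro C₁ C₂ hC₁ hC₂ hC u u₁ u₂ v hu hu₁ hlt hode hv κ f γ rfl rfl rfl
    set D := √(4 * C₁ * C₂ - 1) with hD
    have hD0 : 0 < D := Real.sqrt_pos.2 hC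
    have hD2 : D ^ 2 = 4 * C₁ * C₂ - 1 := Real.sq_sqrt hC.le
    obtain ⟨T, N, hc⟩ := isFrenetCurve_hyperbolicPoint
      (κ := fun s => 1 / (C₁ * Real.exp (2 * s) + C₂ * Real.exp (-2 * s) + D)) hu hu₁ hlt
      (fun s hs => by rw [← hode s hs]; ring) hv
    have d2 : ∀ a s : ℝ, HasDerivAt (fun s : ℝ => a * s) a s := fun a s => by
      simpa using (hasDerivAt_id s).const_mul a
    have hw₁ : ∀ s, HasDerivAt (fun s => C₁ * Real.exp (2 * s) + C₂ * Real.exp (-2 * s) + D)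
        (2 * (C₁ * Real.exp (2 * s) - C₂ * Real.exp (-2 * s))) s := fun s =>
      ((((d2 2 s).exp.const_mul C₁).fun_add ((d2 (-2) s).exp.const_mul C₂)).add_const D).congr_deriv
        (by ring)
    have hw₂ : ∀ s, HasDerivAt (fun s => 2 * (C₁ * Real.exp (2 * s) - C₂ * Real.exp (-2 * s)))
        (4 * (C₁ * Real.exp (2 * s) + C₂ * Real.exp (-2 * s))) s := fun s =>
      ((((d2 2 s).exp.const_mul C₁).fun_sub ((d2 (-2) s).exp.const_mul C₂)).const_mul 2).congr_deriv
        (by ring)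
    have hexp : ∀ s : ℝ, Real.exp (2 * s) * Real.exp (-2 * s) = 1 := fun s => by
      rw [← Real.exp_add]
      simp
    have hApos : ∀ s, 0 < C₁ * Real.exp (2 * s) + C₂ * Real.exp (-2 * s) := fun s => by positivity
    have hcrit := exists_mem_ne_zero hI hne hw₂ fun s _ => (mul_pos four_pos (hApos s)).ne'
    have hsm : ContDiff ℝ ∞ fun s => C₁ * Real.exp (2 * s) + C₂ * Real.exp (-2 * s) + D := by
      fun_prop
    have hwpos : ∀ s, 0 < C₁ * Real.exp (2 * s) + C₂ * Real.exp (-2 * s) + D := fun s =>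
      add_pos (hApos s) hD0
    -- With `A = w - D`, one has `A² - (w'/2)² = 4C₁C₂`, so the equation reduces to `D² = 4C₁C₂ -
    -- 1`.
    have hw_ode : ∀ s, 2 * (C₁ * Real.exp (2 * s) + C₂ * Real.exp (-2 * s) + D) *
        (4 * (C₁ * Real.exp (2 * s) + C₂ * Real.exp (-2 * s)))
        - (2 * (C₁ * Real.exp (2 * s) - C₂ * Real.exp (-2 * s))) ^ 2
        = 4 - 4 * -1 * (C₁ * Real.exp (2 * s) + C₂ * Real.exp (-2 * s) + D) ^ 2 := fun s => by
      linear_combination 16 * C₁ * C₂ * hexp s - 4 * hD2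
    refine ⟨hc.isProperFBiharmonicCurve (isSpaceForm_hyperbolicSpace 2) hI hconn hc₁ hsm hw₁ hw₂
      hwpos hw_ode (fun _ => rfl) (fun _ => rfl) hcrit, fun n ψ hψ => ?_⟩
    obtain ⟨T', N', hc'⟩ := hc.exists_comp hI (isSpaceForm_hyperbolicSpace 2)
      (isSpaceForm_hyperbolicSpace n) hψ (by simp [hyperbolicSpace, lorentzForm,
        Fin.sum_univ_two]) hyperbolicSpace_two_polar
    have key := hc'.isProperFBiharmonicCurve (isSpaceForm_hyperbolicSpace n) hI hconn hc₁ hsm hw₁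
      hw₂ hwpos hw_ode (fun _ => rfl) (fun _ => rfl) hcrit
    exact ⟨key.1, fun s hs => (key.2 s hs).1⟩
  · rintro C₃ C₄ hC x x₁ x₂ y hx hx₁ hlt hode hy κ f γ rfl rfl rfl
    obtain ⟨T, N, hc⟩ := isFrenetCurve_planePoint
      (κ := fun s => 4 * C₃ / (16 + C₃ ^ 2 * (s + C₄) ^ 2)) hx hx₁ hlt
      (fun s hs => by rw [← hode s hs]; ring) hy
    have hden : ∀ s : ℝ, 0 < 16 + C₃ ^ 2 * (s + C₄) ^ 2 := fun s => by positivity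
    have d1 : ∀ s : ℝ, HasDerivAt (fun s : ℝ => s + C₄) 1 s := fun s =>
      (hasDerivAt_id s).add_const C₄
    -- Here `w = 1/κ` is a quadratic polynomial, with constant second derivative `C₃ / 2`.
    have hw₁ : ∀ s, HasDerivAt (fun s => (16 + C₃ ^ 2 * (s + C₄) ^ 2) / (4 * C₃))
        (C₃ * (s + C₄) / 2) s := fun s => by
      refine ((((d1 s).fun_pow 2).const_mul (C₃ ^ 2)).const_add 16).div_const (4 * C₃)
        |>.congr_deriv ?_
      field_simp
      push_cast
      ring
    have hw₂ : ∀ s, HasDerivAt (fun s => C₃ * (s + C₄) / 2) (C₃ / 2) s := fun s => by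
      simpa using ((d1 s).const_mul C₃).div_const 2
    have hcrit := exists_mem_ne_zero hI hne hw₂ fun s _ => (half_pos hC).ne'
    have hsm : ContDiff ℝ ∞ fun s => (16 + C₃ ^ 2 * (s + C₄) ^ 2) / (4 * C₃) := by
      fun_prop
    have hwpos : ∀ s, 0 < (16 + C₃ ^ 2 * (s + C₄) ^ 2) / (4 * C₃) := fun s => by
      have := hden s
      positivity
    have hw_ode : ∀ s, 2 * ((16 + C₃ ^ 2 * (s + C₄) ^ 2) / (4 * C₃)) * (C₃ / 2)
        - (C₃ * (s + C₄) / 2) ^ 2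
        = 4 - 4 * 0 * ((16 + C₃ ^ 2 * (s + C₄) ^ 2) / (4 * C₃)) ^ 2 := fun s => by
      field_simp
      ring
    have hκ : ∀ s, 4 * C₃ / (16 + C₃ ^ 2 * (s + C₄) ^ 2)
        = 1 / ((16 + C₃ ^ 2 * (s + C₄) ^ 2) / (4 * C₃)) := fun s => (one_div_div _ _).symm
    have hf : ∀ s, c₁ * (4 * C₃ / (16 + C₃ ^ 2 * (s + C₄) ^ 2)) ^ (-(3 : ℝ) / 2)
        = c₁ * ((16 + C₃ ^ 2 * (s + C₄) ^ 2) / (4 * C₃)) ^ ((3 : ℝ) / 2) := fun s => by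
      rw [hκ, one_div, Real.inv_rpow (hwpos s).le, ← Real.rpow_neg (hwpos s).le]
      norm_num
    refine ⟨hc.isProperFBiharmonicCurve (isSpaceForm_euclideanSpace 2) hI hconn hc₁ hsm hw₁ hw₂
      hwpos hw_ode hκ hf hcrit, fun n ψ hψ => ?_⟩
    obtain ⟨T', N', hc'⟩ := hc.exists_comp hI (isSpaceForm_euclideanSpace 2)
      (isSpaceForm_euclideanSpace n) hψ (Set.mem_univ _) fun y _ => euclideanSpace_two_polar y
    have key := hc'.isProperFBiharmonicCurve (isSpaceForm_euclideanSpace n) hI hconn hc₁ hsm hw₁ hw₂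
      hwpos hw_ode hκ hf hcrit
    exact ⟨key.1, fun s hs => (key.2 s hs).1⟩
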